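/- Let $(*)$ be the assumption that there is a proper class of cardinals $\kappa$ such that every stationary subset $E'\subseteq\kappa^+$ has a stationary subset $E\subseteq E'$ that is non-reflecting, i.e. $E\cap\alpha$ is not stationary in $\alpha$ for every limit ordinal $\alpha<\kappa^+$. Let $R$ be an associative unital ring and let $M$ be a right $R$-module. Let $\mathrm{Add}(M)$ be the class of all modules isomorphic to direct summands of direct sums of (arbitrarily many) copies of $M$, and let $\varinjlim\mathrm{Add}(M)$ be the class of all direct limits of directed systems of modules from $\mathrm{Add}(M)$. An $\mathrm{Add}(M)$-cover of a module $L$ is a homomorphism $f:C\to L$ with $C\in\mathrm{Add}(M)$ such that, for every $C'\in\mathrm{Add}(M)$, each homomorphism $C'\to L$ factors through $f$, and such that each $g\in\mathrm{End}_R(C)$ with $fg=f$ is an automorphism of $C$. A direct sum $\bigoplus_{i\in I}N_i$ of submodules of a module $N$ is a local direct summand in $N$ if $\bigoplus_{i\in J}N_i$ is a direct summand in $N$ for each finite $J\subseteq I$. The module $M$ has a perfect decomposition if every local direct summand in a module from $\mathrm{Add}(M)$ is a direct summand of that module. **Theorem.** Assume $(*)$. If each module in $\varinjlim\mathrm{Add}(M)$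 has an $\mathrm{Add}(M)$-cover, then $M$ has a perfect decomposition, and $\mathrm{Add}(M)$ is closed under direct limits, i.e. $\varinjlim\mathrm{Add}(M)\subseteq\mathrm{Add}(M)$. -/

import Mathlib

universe u

/-! ### Stationary sets of ordinals and the set-theoretic assumption -/

/-- The set `E ∩ o` is a stationary subset of the ordinal `o` (identified with the set of smaller
ordinals): it meets every closed unbounded subset of `o`. -/
def IsStationaryIn (o : Ordinal.{u}) (E : Set Ordinal.{u}) : Prop :=
  IsStationary ((↑) ⁻¹' E : Set (Set.Iio o))

/-- A subset `E` of the ordinal `o` is non-reflecting if `E ∩ α` is not stationary in `α` for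
every limit ordinal `α < o`. -/
def IsNonReflecting (o : Ordinal.{u}) (E : Set Ordinal.{u}) : Prop :=
  ∀ α < o, Order.IsSuccLimit α → ¬ IsStationaryIn α E

/-- Every stationary subset of `κ⁺` has a non-reflecting stationary subset. -/
def HasNonReflectingSubsets (κ : Cardinal.{u}) : Prop :=
  ∀ E' ⊆ Set.Iio (Order.succ κ).ord, IsStationaryIn (Order.succ κ).ord E' →
    ∃ E ⊆ E', IsStationaryIn (Order.succ κ).ord E ∧ IsNonReflecting (Order.succ κ).ord E

/-- There is a proper class of cardinals `κ` such that every stationary subset of `κ⁺` has a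
non-reflecting stationary subset. (A class of cardinals is proper iff it is unbounded.) -/
def NonReflectionAssumption : Prop :=
  ∀ μ : Cardinal.{u}, ∃ κ : Cardinal.{u}, μ ≤ κ ∧ HasNonReflectingSubsets κ

/-! ### Classes of modules -/

/-- A class of `S`-modules. -/
abbrev ModuleClass (S : Type u) [Ring S] : Type (u + 1) :=
  ∀ (N : Type u) [AddCommGroup N] [Module S N], Prop

section

variable {S : Type u} [Ring S]

/-- `Add(M)`: all modules isomorphic to a direct summand of a direct sum of copies of `M`. -/
def AddClass (M : Type u) [AddCommGroup M] [Module S M] : ModuleClass S :=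
  fun N _ _ => ∃ (I : Type u) (P : Submodule S (I →₀ M)),
    IsComplemented P ∧ Nonempty (N ≃ₗ[S] P)

open Classical in
/-- The class of all (modules isomorphic to) direct limits of systems of modules from `𝒞` indexed
by (nonempty) directed posets. -/
def DirLimClass (𝒞 : ModuleClass S) : ModuleClass S :=
  fun L _ _ => ∃ (I : Type u) (_ : PartialOrder I) (_ : Nonempty I) (_ : IsDirectedOrder I)
    (G : I → Type u) (_ : ∀ i, AddCommGroup (G i)) (_ : ∀ i, Module S (G i))
    (f : ∀ i j, i ≤ j → G i →ₗ[S] G j) (_ : DirectedSystem G (f · · ·)),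
    (∀ i, 𝒞 (G i)) ∧ Nonempty (L ≃ₗ[S] Module.DirectLimit G f)

/-- The class `𝒞` is closed under direct limits. -/
def ClosedUnderDirectLimits (𝒞 : ModuleClass S) : Prop :=
  ∀ (L : Type u) [AddCommGroup L] [Module S L], DirLimClass 𝒞 L → 𝒞 L

/-- `f : C → L` is a `𝒞`-precover of `L`. -/
structure IsPrecover (𝒞 : ModuleClass S) {C L : Type u} [AddCommGroup C] [Module S C]
    [AddCommGroup L] [Module S L] (f : C →ₗ[S] L) : Prop where
  mem : 𝒞 C
  exists_lift : ∀ (C' : Type u) [AddCommGroup C'] [Module S C'], 𝒞 C' →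
    ∀ g : C' →ₗ[S] L, ∃ h : C' →ₗ[S] C, f ∘ₗ h = g

/-- `f : C → L` is a `𝒞`-cover of `L`: a precover such that every endomorphism `g` of `C` with
`f ∘ g = f` is an automorphism. -/
structure IsCover (𝒞 : ModuleClass S) {C L : Type u} [AddCommGroup C] [Module S C]
    [AddCommGroup L] [Module S L] (f : C →ₗ[S] L) : Prop extends IsPrecover 𝒞 f where
  bijective : ∀ g : C →ₗ[S] C, f ∘ₗ g = f → Function.Bijective g

/-- `L` has a `𝒞`-cover. -/
def HasCover (𝒞 : ModuleClass S) (L : Type u) [AddCommGroup L] [Module S L] : Prop :=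
  ∃ (C : Type u) (_ : AddCommGroup C) (_ : Module S C) (f : C →ₗ[S] L), IsCover 𝒞 f

/-- The sum of the submodules `P i` of `N` is direct and is a local direct summand in `N`: every
finite subsum is a direct summand in `N`. -/
structure IsLocalDirectSummand {N : Type u} [AddCommGroup N] [Module S N] {I : Type u}
    (P : I → Submodule S N) : Prop where
  iSupIndep : iSupIndep P
  isComplemented : ∀ J : Finset I, IsComplemented (⨆ i ∈ J, P i)

variable (S) in
/-- `M` has a perfect decomposition: every local direct summand in a module from `Add(M)` is a
direct summand. -/
def HasPerfectDecomposition (M : Type u) [AddCommGroup M] [Module S M] : Prop :=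
  ∀ (N : Type u) [AddCommGroup N] [Module S N], AddClass (S := S) M N →
    ∀ (I : Type u) (P : I → Submodule S N), IsLocalDirectSummand P → IsComplemented (⨆ i, P i)

end

open Cardinal Set

/-! ### Ladder systems on non-reflecting stationary sets -/

/-! Suppose `M` has no perfect decomposition. A non-split local direct summand of least size in some
`N` in `Add(M)` is indexed by a regular cardinal `c`; all its initial partial sums split, but `⨁ B
i` does not. By `(*)` there is a large `κ` and a non-reflecting stationary `E ⊆ κ⁺` of suprema of
ladders of length `c`. Take `κ⁺` copies of `N` and, for each `δ ∈ E`, one more copy whose `B i` is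
identified with the `B i` in the copy at the `i`-th rung of the ladder at `δ`. Non-reflection makes
the ladders below any `α < κ⁺` disjoint after cutting off initial segments, which split anyway, so
the part `X_α` of the glued module `X` lies in `Add(M)` (`LadderDatum.below_mem_addClass`). Hence
`X` is a direct limit of modules in `Add(M)` and has a cover. The domain of the cover is a summand
of a direct sum of copies of `M`, so a closing-off argument and stationarity give `α ∈ E` at which
the cover is compatible with the filtration (`AddClass.exists_endomorphism`). Minimality of the
cover then yields a retraction of `X_α'` onto `X_α` for `α' > α` (`IsCover.exists_retraction`).
Restricted to the copy of `N` at `α`, it extends the ladder embedding of `⨁ B i`; freeness below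
`α'` turns this into a splitting of `⨁ B i` in `N` (`LadderDatum.isComplemented_total`), a
contradiction. For closure under direct limits, the kernel of the canonical map from `⨁ G i` to the
limit is a directed union of direct summands. Perfect decomposition makes unions of well-ordered
chains of summands split, and directed unions reduce to these (`sSup_mem_of_directedOn`). -/

theorem Cardinal.IsRegular.exists_forall_lt {c : Cardinal.{u}} (hc : c.IsRegular)
    {s : Set c.ord.ToType} (hs : #s < c) : ∃ a, ∀ x ∈ s, x < a := by
  rw [← not_isCofinal_iff]
  intro h
  have := Order.cof_le h
  rw [Ordinal.cof_toType, hc.cof_ord] at this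
  exact (this.trans_lt hs).false

theorem Cardinal.IsRegular.exists_forall_lt_of_Iio {c : Cardinal.{u}} (hc : c.IsRegular)
    (f : c.ord.ToType → c.ord.ToType) (j : c.ord.ToType) : ∃ a, ∀ x < j, f x < a := by
  obtain ⟨a, ha⟩ := hc.exists_forall_lt (s := f '' Iio j)
    (mk_image_le.trans_lt ((mk_Iio_lt j (by simp)).trans_eq (by simp)))
  exact ⟨a, fun x hx => ha _ ⟨x, hx, rfl⟩⟩

/-- `h` is a strictly increasing sequence of ordinals of length `c` with supremum `δ`. -/
structure IsLadder (c : Cardinal.{u}) (δ : Ordinal.{u}) (h : c.ord.ToType → Ordinal.{u}) : Prop where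
  strictMono : StrictMono h
  lt : ∀ i, h i < δ
  cofinal : ∀ β < δ, ∃ i, β < h i

/-- Two ladders with different suprema have disjoint tails. -/
theorem IsLadder.exists_tail_ne {c : Cardinal.{u}} (hc : c.IsRegular) {γ δ : Ordinal.{u}} (hδγ : δ < γ)
    {h k : c.ord.ToType → Ordinal.{u}} (hh : IsLadder c δ h) (hk : IsLadder c γ k) :
    ∃ a, ∀ i, a ≤ i → ∀ j, h i ≠ k j := by
  -- From `j₀` on, `k` exceeds `δ`. The fewer than `c` earlier terms that lie below `δ` are
  -- overtaken by a single term of `h`, by regularity.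
  obtain ⟨j₀, hj₀⟩ := hk.cofinal δ hδγ
  have H : ∀ j, ∃ i, k j < δ → k j < h i := fun j => by
    by_cases hj : k j < δ
    · obtain ⟨i, hi⟩ := hh.cofinal _ hj
      exact ⟨i, fun _ => hi⟩
    · exact ⟨j₀, fun h => (hj h).elim⟩
  choose f hf using H
  obtain ⟨a, ha⟩ := hc.exists_forall_lt_of_Iio f j₀
  refine ⟨a, fun i hi j hij => ?_⟩
  rcases lt_or_ge j j₀ with hj | hj
  · have h1 : k j < δ := hij ▸ hh.lt i
    have h2 := hf j h1
    rw [← hij] at h2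
    exact absurd (hh.strictMono.lt_iff_lt.1 h2) (not_lt.2 ((ha j hj).le.trans hi))
  · have h1 : δ < k j := hj₀.trans_le (hk.strictMono.monotone hj)
    exact absurd (hh.lt i) (not_lt.2 (hij ▸ h1.le))

/-- A family of ladders on a non-reflecting set is free: the ladders at the points of any proper
initial segment can be made disjoint by omitting proper initial segments of them. -/
theorem IsNonReflecting.exists_disjoint_tails {c : Cardinal.{u}} (hc : c.IsRegular) {o : Ordinal.{u}}
    {E : Set Ordinal.{u}} (hE : IsNonReflecting o E) {η : Ordinal.{u} → c.ord.ToType → Ordinal.{u}}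
    (hη : ∀ δ ∈ E, IsLadder c δ (η δ)) (α : Ordinal.{u}) (hα : α < o) (β : Ordinal.{u}) :
    ∃ g : Ordinal.{u} → c.ord.ToType, (∀ δ ∈ E, β < δ → δ < α → ∀ i, g δ ≤ i → β < η δ i) ∧
      ∀ δ ∈ E, β < δ → δ < α → ∀ δ' ∈ E, β < δ' → δ' < α → δ ≠ δ' →
        ∀ i, g δ ≤ i → ∀ i', g δ' ≤ i' → η δ i ≠ η δ' i' := by
  have hne : Nonempty c.ord.ToType := by
    rw [← mk_ne_zero_iff, mk_toType, card_ord]; exact hc.pos.ne'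
  -- The lower bound `β` on the tails is what allows solutions on consecutive intervals to be
  -- combined at limits.
  induction α using WellFoundedLT.induction generalizing β with
  | ind α ih =>
  rcases Ordinal.zero_or_succ_or_isSuccLimit α with rfl | ⟨γ, rfl⟩ | hlim
  · exact ⟨fun _ => hne.some, fun δ _ _ h => absurd h (not_lt.2 (zero_le (a := δ))),
      fun δ _ _ h => absurd h (not_lt.2 (zero_le (a := δ)))⟩
  · have hγ : γ < Order.succ γ := Order.lt_succ γ
    obtain ⟨g, hg₁, hg₂⟩ := ih γ hγ (hγ.trans hα) β
    by_cases hγE : γ ∈ E ∧ β < γ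
    · have H : ∀ δ, ∃ a, δ ∈ E → δ < γ → ∀ i, a ≤ i → ∀ j, η δ i ≠ η γ j := fun δ => by
        by_cases hδ : δ ∈ E ∧ δ < γ
        · obtain ⟨a, ha⟩ := (hη δ hδ.1).exists_tail_ne hc hδ.2 (hη γ hγE.1)
          exact ⟨a, fun _ _ => ha⟩
        · exact ⟨hne.some, fun h h' => (hδ ⟨h, h'⟩).elim⟩
      choose a ha using H
      obtain ⟨b, hb⟩ := (hη γ hγE.1).cofinal β hγE.2
      classical
      refine ⟨fun δ => if δ = γ then b else max (g δ) (a δ), ?_, ?_⟩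
      · intro δ hδ hβδ hδα i hi
        by_cases h : δ = γ
        · subst h
          simp only [if_true] at hi
          exact hb.trans_le ((hη δ hδ).strictMono.monotone hi)
        · simp only [h, if_false, max_le_iff] at hi
          exact hg₁ δ hδ hβδ (lt_of_le_of_ne (Order.lt_succ_iff.1 hδα) h) i hi.1
      · intro δ hδ hβδ hδα δ' hδ' hβδ' hδα' hne i hi i' hi'
        by_cases h : δ = γ
        · subst h
          have h' : δ' ≠ δ := hne.symm
          simp only [h', if_false, max_le_iff] at hi'
          exact (ha δ' hδ' (lt_of_le_of_ne (Order.lt_succ_iff.1 hδα') h') i' hi'.2 i).symm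
        · simp only [h, if_false, max_le_iff] at hi
          have hlt := lt_of_le_of_ne (Order.lt_succ_iff.1 hδα) h
          by_cases h' : δ' = γ
          · subst h'
            exact ha δ hδ hlt i hi.2 i'
          · simp only [h', if_false, max_le_iff] at hi'
            exact hg₂ δ hδ hβδ hlt δ' hδ' hβδ' (lt_of_le_of_ne (Order.lt_succ_iff.1 hδα') h')
              hne i hi.1 i' hi'.1
    · refine ⟨g, fun δ hδ hβδ hδα => ?_, fun δ hδ hβδ hδα δ' hδ' hβδ' hδα' => ?_⟩
      · have : δ ≠ γ := by rintro rfl; exact hγE ⟨hδ, hβδ⟩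
        exact hg₁ δ hδ hβδ (lt_of_le_of_ne (Order.lt_succ_iff.1 hδα) this)
      · have h1 : δ ≠ γ := by rintro rfl; exact hγE ⟨hδ, hβδ⟩
        have h2 : δ' ≠ γ := by rintro rfl; exact hγE ⟨hδ', hβδ'⟩
        exact hg₂ δ hδ hβδ (lt_of_le_of_ne (Order.lt_succ_iff.1 hδα) h1) δ' hδ' hβδ'
          (lt_of_le_of_ne (Order.lt_succ_iff.1 hδα') h2)
  -- Non-reflection gives a club missing `E`. It cuts the points of `E` into gaps, each handled by
  -- the induction hypothesis; `a δ` below is the last point of `C` before `δ`.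
  · obtain ⟨t, ht, hdisj⟩ := not_isStationary_iff.1 (hE α hα hlim)
    -- the points of the club, together with `β`
    let C : Set Ordinal.{u} := insert β (Subtype.val '' t)
    have hCE : ∀ x ∈ C, x ∈ E → x = β := by
      rintro x (rfl | ⟨y, hy, rfl⟩) hx
      · rfl
      · exact (Set.disjoint_left.1 hdisj hx hy).elim
    have hlow : ∀ δ, ∃ a, δ ∈ E → β < δ → δ < α → a ∈ C ∧ a < δ ∧ ∀ x ∈ C, x < δ → x ≤ a := by
      intro δ
      by_cases h : δ ∈ E ∧ β < δ ∧ δ < α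
      · obtain ⟨hδ, hβδ, hδα⟩ := h
        let D : Set Ordinal.{u} := {x | x ∈ C ∧ x < δ}
        have hDβ : β ∈ D := ⟨mem_insert _ _, hβδ⟩
        have hDb : BddAbove D := ⟨δ, fun x hx => hx.2.le⟩
        have hlub : IsLUB D (sSup D) := isLUB_csSup ⟨β, hDβ⟩ hDb
        have hle : sSup D ≤ δ := hlub.2 fun x hx => hx.2.le
        have hmem : sSup D ∈ C := by
          by_cases hD : ∃ x ∈ D, x ≠ β ∧ β ≤ x
          · right
            obtain ⟨x₀, hx₀, hx₀β, hx₀'⟩ := hD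
            have hlt : sSup D < α := hle.trans_lt hδα
            refine ⟨⟨sSup D, hlt⟩, ?_, rfl⟩
            have hx₀t : x₀ ∈ Subtype.val '' t := hx₀.1.resolve_left hx₀β
            obtain ⟨y₀, hy₀, rfl⟩ := hx₀t
            refine ht.dirSupClosed (d := {y | y ∈ t ∧ y.1 < δ}) (fun y hy => hy.1)
              ⟨y₀, hy₀, hx₀.2⟩ (IsChain.directedOn (fun a _ b _ _ => le_total a b)) ⟨?_, ?_⟩
            · exact fun y hy => hlub.1 ⟨Or.inr ⟨y, hy.1, rfl⟩, hy.2⟩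
            · intro z hz
              refine hlub.2 ?_
              rintro x ⟨rfl | ⟨y, hy, rfl⟩, hx⟩
              · exact hx₀'.trans (hz ⟨hy₀, hx₀.2⟩)
              · exact hz ⟨hy, hx⟩
          · have : sSup D = β := by
              refine le_antisymm (hlub.2 fun x hx => ?_) (hlub.1 hDβ)
              by_contra hxβ
              exact hD ⟨x, hx, fun h => hxβ h.le, (not_le.1 hxβ).le⟩
            rw [this]; exact mem_insert _ _
        refine ⟨sSup D, fun _ _ _ => ⟨hmem, lt_of_le_of_ne hle ?_, fun x hx hxδ => hlub.1 ⟨hx, hxδ⟩⟩⟩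
        intro heq
        exact hβδ.ne' (hCE δ (heq ▸ hmem) hδ)
      · exact ⟨0, fun h1 h2 h3 => (h ⟨h1, h2, h3⟩).elim⟩
    choose a ha using hlow
    have hup : ∀ x, ∃ b, x < α → b < α ∧ x < b ∧ b ∈ C := by
      intro x
      by_cases hx : x < α
      · obtain ⟨y, hy, hxy⟩ := ht.isCofinal ⟨Order.succ x, hlim.succ_lt hx⟩
        exact ⟨y, fun _ => ⟨y.2, (Order.lt_succ x).trans_le hxy, Or.inr ⟨y, hy, rfl⟩⟩⟩
      · exact ⟨0, fun h => (hx h).elim⟩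
    choose b hb using hup
    have hih : ∀ x, ∃ g : Ordinal.{u} → c.ord.ToType, x < α →
        (∀ δ ∈ E, x < δ → δ < b x → ∀ i, g δ ≤ i → x < η δ i) ∧
        ∀ δ ∈ E, x < δ → δ < b x → ∀ δ' ∈ E, x < δ' → δ' < b x → δ ≠ δ' →
        ∀ i, g δ ≤ i → ∀ i', g δ' ≤ i' → η δ i ≠ η δ' i' := fun x => by
      by_cases hx : x < α
      · obtain ⟨g, hg⟩ := ih (b x) (hb x hx).1 ((hb x hx).1.trans hα) x
        exact ⟨g, fun _ => hg⟩
      · exact ⟨fun _ => hne.some, fun h => (hx h).elim⟩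
    choose G hG using hih
    -- `b x` need not be the next point of `C` after `x`, but `b (a δ)` cannot lie below `δ`, by
    -- maximality of `a δ`.
    have hgap : ∀ δ, δ ∈ E → β < δ → δ < α → a δ < δ ∧ δ < b (a δ) ∧ β ≤ a δ ∧ a δ < α := by
      intro δ hδ hβδ hδα
      obtain ⟨h1, h2, h3⟩ := ha δ hδ hβδ hδα
      have h4 : β ≤ a δ := h3 β (mem_insert _ _) hβδ
      have h5 := h2.trans hδα
      refine ⟨h2, ?_, h4, h5⟩
      by_contra h6
      rw [not_lt] at h6
      obtain ⟨-, h8, h9⟩ := hb (a δ) h5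
      have h10 : b (a δ) ≠ δ := fun h => hβδ.ne' (hCE δ (h ▸ h9) hδ)
      exact absurd (h3 _ h9 (lt_of_le_of_ne h6 h10)) (not_le.2 h8)
    refine ⟨fun δ => G (a δ) δ, ?_, ?_⟩
    · intro δ hδ hβδ hδα i hi
      obtain ⟨h2, h3, h4, h5⟩ := hgap δ hδ hβδ hδα
      exact h4.trans_lt ((hG (a δ) h5).1 δ hδ h2 h3 i hi)
    · have key : ∀ δ ∈ E, β < δ → δ < α → ∀ δ' ∈ E, β < δ' → δ' < α → δ < δ' →
          ∀ i, G (a δ) δ ≤ i → ∀ i', G (a δ') δ' ≤ i' → η δ i ≠ η δ' i' := by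
        intro δ hδ hβδ hδα δ' hδ' hβδ' hδα' hlt i hi i' hi'
        obtain ⟨h2, h3, h4, h5⟩ := hgap δ hδ hβδ hδα
        obtain ⟨h2', h3', h4', h5'⟩ := hgap δ' hδ' hβδ' hδα'
        by_cases heq : a δ = a δ'
        · rw [← heq] at hi' h2' h3'
          exact (hG (a δ) h5).2 δ hδ h2 h3 δ' hδ' h2' h3' hlt.ne i hi i' hi'
        -- In different gaps, the whole ladder at `δ` stays below `a δ'`, and the tail at `δ'` lies
        -- above it.
        · have h6 : δ < a δ' := by
            by_contra hcon
            rw [not_lt] at hcon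
            have haC := (ha δ' hδ' hβδ' hδα').1
            have h7 : a δ' < δ := lt_of_le_of_ne hcon fun h =>
              hβδ.ne' (hCE δ (h ▸ haC) hδ)
            exact heq (le_antisymm ((ha δ' hδ' hβδ' hδα').2.2 _ (ha δ hδ hβδ hδα).1 (h2.trans hlt))
              ((ha δ hδ hβδ hδα).2.2 _ haC h7))
          have h8 := (hG (a δ') h5').1 δ' hδ' h2' h3' i' hi'
          exact ((((hη δ hδ).lt i).trans h6).trans h8).ne
      intro δ hδ hβδ hδα δ' hδ' hβδ' hδα' hne i hi i' hi'
      rcases lt_or_gt_of_ne hne with h | h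
      · exact key δ hδ hβδ hδα δ' hδ' hβδ' hδα' h i hi i' hi'
      · exact (key δ' hδ' hβδ' hδα' δ hδ hβδ hδα h i' hi' i hi).symm

/-- The suprema of ladders of length `c` form a stationary subset of every larger regular
cardinal. -/
theorem isStationaryIn_setOf_isLadder {c d : Cardinal.{u}} (hc : c.IsRegular) (hd : d.IsRegular)
    (hcd : c < d) : IsStationaryIn d.ord {δ | δ < d.ord ∧ ∃ h, IsLadder c δ h} := by
  intro t ht
  -- Inside a given club `t`, choose by recursion `c` points, each above all earlier ones. Their
  -- supremum stays below `d`, lies in `t`, and has this sequence as its ladder.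
  have hnext : ∀ s : Set (Iio d.ord), lift.{u + 1} c > #s → ∃ y ∈ t, ∀ x ∈ s, x < y := by
    intro s hs
    obtain ⟨a, ha⟩ : ∃ a, ∀ x ∈ s, x < a := by
      rw [← not_isCofinal_iff]
      intro h
      have h1 := Order.cof_le h
      rw [Ordinal.cof_Iio, ← Ordinal.lift_cof, hd.cof_ord] at h1
      exact absurd (h1.trans_lt hs) (not_lt.2 (lift_le.2 hcd.le))
    obtain ⟨y, hy, hay⟩ := ht.isCofinal a
    exact ⟨y, hy, fun x hx => (ha x hx).trans_le hay⟩
  have hne : Nonempty (Iio d.ord) := ⟨⟨0, by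
    rw [mem_Iio, pos_iff_ne_zero, Ne, ord_eq_zero]; exact hd.pos.ne'⟩⟩
  choose! pick hpick using hnext
  let f : c.ord.ToType → Iio d.ord :=
    WellFoundedLT.fix fun i ih => pick (range fun j : Iio i => ih j.1 j.2)
  have hf : ∀ i, f i = pick (range fun j : Iio i => f j.1) := fun i => WellFoundedLT.fix_eq _ i
  have hcard : ∀ i, lift.{u + 1} c > #(range fun j : Iio i => f j.1) := fun i => by
    have h1 := mk_range_le_lift (f := fun j : Iio i => f j.1)
    rw [lift_id'.{u, u + 1}] at h1
    refine h1.trans_lt ?_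
    rw [lift_lt]
    exact (mk_Iio_lt i (by simp)).trans_eq (by simp)
  have hft : ∀ i, f i ∈ t := fun i => by rw [hf]; exact (hpick _ (hcard i)).1
  have hmono : StrictMono f := fun j i hji => by
    rw [hf i]; exact (hpick _ (hcard i)).2 _ ⟨⟨j, hji⟩, rfl⟩
  have : NoMaxOrder c.ord.ToType := Cardinal.noMaxOrder hc.aleph0_le
  have hcne : Nonempty c.ord.ToType := by
    rw [← mk_ne_zero_iff, mk_toType, card_ord]; exact hc.pos.ne'
  have hb : BddAbove (range fun i => (f i).1) := ⟨d.ord, by rintro _ ⟨i, rfl⟩; exact (f i).2.le⟩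
  let δ : Ordinal.{u} := ⨆ i, (f i).1
  have hδ : δ < d.ord := by
    refine Ordinal.iSup_lt_of_lt_cof ?_ fun i => (f i).2
    rw [hd.cof_ord, mk_toType, card_ord]
    exact hcd
  refine ⟨⟨δ, hδ⟩, ⟨hδ, fun i => (f i).1, hmono, fun i => ?_, fun β hβ => ?_⟩, ?_⟩
  · obtain ⟨j, hj⟩ := exists_gt i
    exact lt_of_lt_of_le (hmono hj) (le_ciSup hb j)
  · exact exists_lt_of_lt_ciSup hβ
  · refine ht.dirSupClosed (d := range f) (by rintro _ ⟨i, rfl⟩; exact hft i) (range_nonempty f)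
      (IsChain.directedOn (fun a _ b _ _ => le_total a b)) ⟨?_, ?_⟩
    · rintro _ ⟨i, rfl⟩
      exact le_ciSup hb i
    · intro z hz
      exact show δ ≤ z.1 from ciSup_le fun i => show (f i).1 ≤ z.1 from hz ⟨i, rfl⟩

/-- A stationary subset of a regular uncountable cardinal contains a point closed under any given
function. -/
theorem IsStationaryIn.exists_forall_lt {d : Cardinal.{u}} (hd : d.IsRegular) (hd' : ℵ₀ < d)
    {E : Set Ordinal.{u}} (hE : IsStationaryIn d.ord E) (ψ : Iio d.ord → Iio d.ord) :
    ∃ α : Iio d.ord, α.1 ∈ E ∧ ∀ β < α, ψ β < α := by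
  have hbd : ∀ s : Set (Iio d.ord), #s < lift.{u + 1} d → ∃ a, ∀ x ∈ s, x < a := fun s hs => by
    rw [← not_isCofinal_iff]
    intro h
    have h1 := Order.cof_le h
    rw [Ordinal.cof_Iio, ← Ordinal.lift_cof, hd.cof_ord] at h1
    exact absurd (h1.trans_lt hs) (lt_irrefl _)
  have hstep : ∀ x : Iio d.ord, ∃ y, x < y ∧ ∀ β < x, ψ β < y := fun x => by
    obtain ⟨y, hy⟩ := hbd (insert x (ψ '' Iio x)) (by
      refine (mk_insert_le).trans_lt (add_lt_of_lt ?_ ?_ ?_)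
      · rw [aleph0_le_lift]; exact hd.aleph0_le
      · refine mk_image_le.trans_lt ?_
        have h1 : #(Iio x) ≤ #(Iio x.1) :=
          mk_le_of_injective (f := fun y => ⟨y.1.1, y.2⟩) fun a b h => by
            exact Subtype.ext (Subtype.ext (congrArg (fun z : Iio x.1 => z.1) h))
        rw [mk_Iio_ordinal] at h1
        exact h1.trans_lt (lift_lt.2 (lt_ord.1 x.2))
      · rw [one_lt_lift_iff]; exact one_lt_aleph0.trans hd')
    exact ⟨y, hy x (mem_insert _ _), fun β hβ => hy _ (mem_insert_of_mem _ ⟨β, hβ, rfl⟩)⟩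
  choose nx hnx using hstep
  let t : Set (Iio d.ord) := {α | ∀ β < α, ψ β < α}
  -- Unboundedness comes from iterating `nx` countably often; the supremum stays below `d`, which is
  -- regular and uncountable.
  have ht : IsClub t := by
    constructor
    · intro s hs hne _ a ha β hβ
      obtain ⟨x, hx, hβx⟩ := (lt_isLUB_iff ha).1 hβ
      exact (hs hx β hβx).trans_le (ha.1 hx)
    · intro x
      let y : ℕ → Iio d.ord := fun n => nx^[n] x
      have hy : ∀ n, y (n + 1) = nx (y n) := fun n => Function.iterate_succ_apply' _ _ _
      have hb : BddAbove (range fun i => (y i).1) :=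
        ⟨d.ord, by rintro _ ⟨i, rfl⟩; exact (y i).2.le⟩
      have hlt : (⨆ n, (y n).1) < d.ord := by
        refine Ordinal.lift_iSup_lt_of_lt_cof ?_ fun i => (y i).2
        rw [← Ordinal.lift_cof, hd.cof_ord]
        simpa using hd'
      refine ⟨⟨_, hlt⟩, fun β hβ => ?_, le_ciSup hb 0⟩
      obtain ⟨n, hn⟩ := exists_lt_of_lt_ciSup (show β.1 < ⨆ n, (y n).1 from hβ)
      refine lt_of_lt_of_le ((hnx (y n)).2 β hn) ?_
      rw [← hy]
      exact le_ciSup hb (n + 1)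
  obtain ⟨α, hα, hαt⟩ := hE ht
  exact ⟨α, hα, hαt⟩

/-- A well-order `Ω` in which sets of cardinality at most `κ` are bounded, together with a
stationary set `E` and ladders of length `c` on `E`, such that the ladders at the points of any
proper initial segment have pairwise disjoint tails. -/
theorem NonReflectionAssumption.exists_free_ladder_system (hstar : NonReflectionAssumption.{u})
    {c : Cardinal.{u}} (hc : c.IsRegular) (ν : Cardinal.{u}) :
    ∃ (κ : Cardinal.{u}) (_ : ν ≤ κ) (_ : ℵ₀ ≤ κ) (Ω : Type u) (_ : LinearOrder Ω)
      (_ : WellFoundedLT Ω) (E : Set Ω) (η : Ω → c.ord.ToType → Ω),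
      Nonempty Ω ∧ (∀ s : Set Ω, #s ≤ κ → ∃ a, ∀ x ∈ s, x < a) ∧
      (∀ δ ∈ E, StrictMono (η δ) ∧ ∀ i, η δ i < δ) ∧
      (∀ ψ : Ω → Ω, ∃ α ∈ E, ∀ β < α, ψ β < α) ∧
      ∀ α : Ω, ∃ g : Ω → c.ord.ToType, ∀ δ ∈ E, δ < α → ∀ δ' ∈ E, δ' < α → δ ≠ δ' →
        ∀ i, g δ ≤ i → ∀ i', g δ' ≤ i' → η δ i ≠ η δ' i' := by
  obtain ⟨κ, hκ, hnr⟩ := hstar (max (max c ν) ℵ₀)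
  simp only [max_le_iff] at hκ
  obtain ⟨⟨hcκ, hνκ⟩, hκ⟩ := hκ
  have hd := isRegular_succ hκ
  have hd' : ℵ₀ < Order.succ κ := Order.lt_succ_iff.2 hκ
  obtain ⟨E, hEs, hE, hEnr⟩ := hnr _ (fun x hx => hx.1)
    (isStationaryIn_setOf_isLadder hc hd (Order.lt_succ_iff.2 hcκ))
  have hlad : ∀ δ, ∃ h, δ ∈ E → IsLadder c δ h := fun δ => by
    by_cases h : δ ∈ E
    · obtain ⟨k, hk⟩ := (hEs h).2
      exact ⟨k, fun _ => hk⟩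
    · exact ⟨fun _ => 0, fun h' => (h h').elim⟩
  choose η hη using hlad
  -- `Iio O` lives one universe too high, so everything is transported to `O.ToType`.
  let O := (Order.succ κ).ord
  let e : Iio O ≃o O.ToType := Ordinal.ToType.mk
  have hne : Nonempty O.ToType := by
    rw [← mk_ne_zero_iff, mk_toType, card_ord]; exact hd.pos.ne'
  let o : O.ToType → Ordinal.{u} := fun x => (e.symm x).1
  have ho : ∀ x, o x < O := fun x => (e.symm x).2
  have homono : ∀ {x y}, o x < o y ↔ x < y := fun {x y} => e.symm.lt_iff_lt
  have hsymm : ∀ x h, o (e ⟨x, h⟩) = x := fun x h => by simp [o]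
  have hη' : ∀ (δ : O.ToType) (i : c.ord.ToType), ∃ x, o δ ∈ E → o x = η (o δ) i := fun δ i => by
    by_cases h : o δ ∈ E
    · exact ⟨e ⟨_, ((hη _ h).lt i).trans (ho δ)⟩, fun _ => hsymm _ _⟩
    · exact ⟨δ, fun h' => (h h').elim⟩
  choose η' hη' using hη'
  refine ⟨κ, hνκ, hκ, O.ToType, inferInstance, inferInstance, o ⁻¹' E, η', hne,
    fun s hs => ?_, fun δ hδ => ⟨fun i j hij => ?_, fun i => ?_⟩, fun ψ => ?_, fun α => ?_⟩
  · exact hd.exists_forall_lt (Order.lt_succ_iff.2 hs)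
  · rw [← homono, hη' δ _ hδ, hη' δ _ hδ]
    exact (hη _ hδ).strictMono hij
  · rw [← homono, hη' δ _ hδ]
    exact (hη _ hδ).lt i
  · obtain ⟨α, hα, h⟩ := hE.exists_forall_lt hd hd' fun x => e.symm (ψ (e x))
    refine ⟨e α, by simpa [o] using hα, fun β hβ => ?_⟩
    have := h (e.symm β) (by rwa [← e.lt_iff_lt, e.apply_symm_apply])
    rwa [e.apply_symm_apply, ← e.lt_iff_lt, e.apply_symm_apply] at this
  -- The bound `β = 0` excludes no point of `E`, since a point with a ladder below it is nonzero.
  · obtain ⟨g, -, hg⟩ := IsNonReflecting.exists_disjoint_tails hc hEnr hη (o α) (ho α) 0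
    have h0 : ∀ δ ∈ E, 0 < δ := fun δ hδ => by
      obtain ⟨i⟩ : Nonempty c.ord.ToType := by
        rw [← mk_ne_zero_iff, mk_toType, card_ord]; exact hc.pos.ne'
      exact (zero_le (a := _)).trans_lt ((hη δ hδ).lt i)
    refine ⟨g ∘ o, fun δ hδ hδα δ' hδ' hδα' hne i hi i' hi' heq => ?_⟩
    refine hg _ hδ (h0 _ hδ) (homono.2 hδα) _ hδ' (h0 _ hδ') (homono.2 hδα')
      (fun h => hne (e.symm.injective (Subtype.ext h))) i hi i' hi' ?_
    rw [← hη' δ i hδ, ← hη' δ' i' hδ', heq]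

/-! ### Directed suprema and well-ordered suprema -/

theorem Cardinal.mk_iUnion_iterate_le {A : Type u} {F : Set A → Set A} {c : Cardinal.{u}}
    (hc : ℵ₀ ≤ c) (hF : ∀ S : Set A, #S ≤ c → #(F S) ≤ c) {S : Set A} (hS : #S ≤ c) :
    #(⋃ n : ℕ, F^[n] S) ≤ c := by
  have h : ∀ n, #(F^[n] S : Set A) ≤ c := fun n => by
    induction n with
    | zero => exact hS
    | succ n ih => rw [Function.iterate_succ_apply']; exact hF _ ih
  have h1 := mk_iUnion_le_lift (fun n : ℕ => F^[n] S)
  rw [lift_id'.{0, u}] at h1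
  refine h1.trans (mul_le_of_le hc (by simpa using hc) ?_)
  exact ciSup_le' fun n => by simpa using h n

/-- A set in a complete lattice which is closed under suprema of well-ordered monotone families is
closed under directed suprema. -/
theorem sSup_mem_of_directedOn {α : Type u} [CompleteLattice α] {K : Set α}
    (hK : ∀ (T : Type u) [LinearOrder T] [WellFoundedLT T] [Nonempty T] (k : T → α), Monotone k →
      (∀ t, k t ∈ K) → ⨆ t, k t ∈ K) {D : Set α} (hDK : D ⊆ K) (hne : D.Nonempty)
    (hD : DirectedOn (· ≤ ·) D) : sSup D ∈ K := by
  induction hc : #D using WellFoundedLT.induction generalizing D with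
  | ind c ih =>
  subst hc
  rcases le_or_gt #D ℵ₀ with hcount | hunc
  · have : Countable D := mk_le_aleph0_iff.1 hcount
    obtain ⟨_⟩ := nonempty_encodable D
    have : Inhabited D := ⟨⟨_, hne.some_mem⟩⟩
    have hdir : Directed (· ≤ ·) (Subtype.val : D → α) := directedOn_iff_directed.1 hD
    let k : ULift.{u} ℕ → α := fun n => (hdir.sequence _ n.down).1
    have hk : Monotone k := fun m n hmn => hdir.sequence_mono hmn
    have h := hK (ULift.{u} ℕ) k hk fun n => hDK (hdir.sequence _ n.down).2
    have heq : ⨆ n, k n = sSup D := by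
      refine le_antisymm (iSup_le fun n => le_sSup (hdir.sequence _ n.down).2)
        (sSup_le fun d hd => ?_)
      exact (hdir.le_sequence ⟨d, hd⟩).trans (le_iSup k ⟨_⟩)
    rwa [heq] at h
  · choose! ub hubD hub₁ hub₂ using hD
    let ub' : D → D → D := fun x y => ⟨ub x y, hubD x x.2 y y.2⟩
    let F : Set D → Set D := fun S => S ∪ image2 ub' S S
    have hF : Monotone F := fun S S' h => union_subset_union h (image2_subset h h)
    have hFi : ∀ S, S ⊆ F S := fun S => subset_union_left
    obtain ⟨e⟩ : Nonempty ((#D).ord.ToType ≃ D) := Cardinal.eq.1 (by simp)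
    -- Closing initial segments of an enumeration of `D` under upper bounds gives an increasing
    -- chain of directed sets, each smaller than `D`, with union `D`.
    let G : (#D).ord.ToType → Set D := fun a => ⋃ n : ℕ, F^[n] (e '' Iic a)
    have hGcard : ∀ a, #(G a) < #D := fun a => by
      have h1 : #(e '' Iic a) < #D := by
        refine mk_image_le.trans_lt ?_
        rw [← Iio_insert]
        refine mk_insert_le.trans_lt (add_lt_of_lt hunc.le ?_ (one_lt_aleph0.trans hunc))
        exact (mk_Iio_lt a (by simp)).trans_eq (by simp)
      refine (mk_iUnion_iterate_le (c := max #(e '' Iic a) ℵ₀) (le_max_right _ _) ?_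
        (le_max_left _ _)).trans_lt (max_lt h1 hunc)
      intro S hS
      refine (mk_union_le _ _).trans (add_le_of_le (le_max_right _ _) hS ?_)
      rw [← image_uncurry_prod]
      refine mk_image_le.trans ?_
      rw [mk_setProd]
      exact mul_le_of_le (le_max_right _ _) (by simpa using hS) (by simpa using hS)
    have hit : ∀ S : Set D, Monotone fun n : ℕ => F^[n] S := fun S =>
      monotone_nat_of_le_succ fun n => by
        rw [Function.iterate_succ_apply']; exact hFi _
    have hGdir : ∀ a, DirectedOn (· ≤ ·) (Subtype.val '' G a) := by
      rintro a _ ⟨x, hx, rfl⟩ _ ⟨y, hy, rfl⟩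
      obtain ⟨n, hn⟩ := mem_iUnion.1 hx
      obtain ⟨m, hm⟩ := mem_iUnion.1 hy
      refine ⟨_, ⟨ub' x y, mem_iUnion.2 ⟨max n m + 1, ?_⟩, rfl⟩, hub₁ _ x.2 _ y.2,
        hub₂ _ x.2 _ y.2⟩
      rw [Function.iterate_succ_apply']
      exact Or.inr ⟨x, hit _ (le_max_left n m) hn, y, hit _ (le_max_right n m) hm, rfl⟩
    have hGne : ∀ a, e a ∈ G a := fun a => mem_iUnion.2 ⟨0, a, mem_Iic.2 le_rfl, rfl⟩
    have : Nonempty (#D).ord.ToType := ⟨e.symm ⟨_, hne.some_mem⟩⟩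
    have h := hK _ (fun a => sSup (Subtype.val '' G a))
      (fun a b hab => sSup_le_sSup (image_mono (iUnion_mono fun n =>
        hF.iterate n (image_mono (Iic_subset_Iic.2 hab)))))
      (fun a => ih _ ((mk_image_le).trans_lt (hGcard a))
        (by rintro _ ⟨x, -, rfl⟩; exact hDK x.2) ⟨_, _, hGne a, rfl⟩ (hGdir a) rfl)
    have heq : ⨆ a, sSup (Subtype.val '' G a) = sSup D := by
      refine le_antisymm (iSup_le fun a => sSup_le ?_) (sSup_le fun d hd => ?_)
      · rintro _ ⟨x, -, rfl⟩
        exact le_sSup x.2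
      · refine le_iSup_of_le (e.symm ⟨d, hd⟩) (le_sSup ⟨⟨d, hd⟩, ?_, rfl⟩)
        simpa using hGne (e.symm ⟨d, hd⟩)
    rwa [heq] at h

/-! ### Direct summands -/

/-- If `w` is a complement of `x`, then `w ⊓ a` complements `x` inside `a`; adding it to a
complement of `a ⊔ h` gives a complement of `x ⊔ h`. -/
theorem IsComplemented.sup_of_le {α : Type*} [Lattice α] [BoundedOrder α] [IsModularLattice α]
    {x a h : α} (hx : IsComplemented x) (hxa : x ≤ a) (hah : Disjoint a h)
    (hc : IsComplemented (a ⊔ h)) : IsComplemented (x ⊔ h) := by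
  obtain ⟨w, hw⟩ := hx
  obtain ⟨z, hz⟩ := hc
  have h1 : x ⊔ w ⊓ a = a := by
    rw [← sup_inf_assoc_of_le w hxa, hw.sup_eq_top, top_inf_eq]
  have h2 : Disjoint x (w ⊓ a) := hw.disjoint.mono_right inf_le_left
  have h3 : Disjoint (w ⊓ a) (x ⊔ h) := by
    refine h2.symm.disjoint_sup_right_of_disjoint_sup_left ?_
    rwa [sup_comm, h1]
  have h4 : x ⊔ h ⊔ w ⊓ a = a ⊔ h := by rw [sup_right_comm, h1]
  refine ⟨w ⊓ a ⊔ z, h3.symm.disjoint_sup_right_of_disjoint_sup_left ?_, ?_⟩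
  · rw [h4]; exact hz.disjoint
  · rw [codisjoint_iff, ← sup_assoc, h4, hz.sup_eq_top]

section

variable {S : Type u} [Ring S]

theorem Submodule.isComplemented_iff_exists_proj {N : Type*} [AddCommGroup N] [Module S N]
    {K : Submodule S N} :
    IsComplemented K ↔ ∃ p : N →ₗ[S] N, (∀ x, p x ∈ K) ∧ ∀ x ∈ K, p x = x := by
  constructor
  · rintro ⟨W, hW⟩
    exact ⟨K.projection W hW, fun x => projection_apply_mem _ x,
      fun x hx => projection_apply_of_mem_left _ hx⟩
  · rintro ⟨p, hp, hp'⟩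
    exact ⟨_, LinearMap.isCompl_of_proj (f := p.codRestrict K hp) fun x => Subtype.ext (hp' x x.2)⟩

variable {M : Type u} [AddCommGroup M] [Module S M]

theorem addClass_iff {N : Type u} [AddCommGroup N] [Module S N] :
    AddClass (S := S) M N ↔ ∃ (I : Type u) (i : N →ₗ[S] (I →₀ M)) (p : (I →₀ M) →ₗ[S] N),
      ∀ x, p (i x) = x := by
  constructor
  · rintro ⟨I, P, ⟨W, hW⟩, ⟨e⟩⟩
    exact ⟨I, P.subtype ∘ₗ e, e.symm ∘ₗ P.projectionOnto W hW, fun x => by simp⟩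
  · rintro ⟨I, i, p, h⟩
    refine ⟨I, LinearMap.range i, ?_,
      ⟨LinearEquiv.ofInjective i (Function.LeftInverse.injective h)⟩⟩
    rw [Submodule.isComplemented_iff_exists_proj]
    refine ⟨i ∘ₗ p, fun x => ⟨p x, rfl⟩, ?_⟩
    rintro _ ⟨x, rfl⟩
    simp [h]

theorem AddClass.of_retract {N N' : Type u} [AddCommGroup N] [Module S N] [AddCommGroup N']
    [Module S N'] (hN : AddClass (S := S) M N) (i : N' →ₗ[S] N) (p : N →ₗ[S] N')
    (h : ∀ x, p (i x) = x) : AddClass (S := S) M N' := by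
  rw [addClass_iff] at hN ⊢
  obtain ⟨I, j, q, hq⟩ := hN
  exact ⟨I, j ∘ₗ i, p ∘ₗ q, fun x => by simp [hq, h]⟩

theorem AddClass.finsupp {N : Type u} [AddCommGroup N] [Module S N] (hN : AddClass (S := S) M N)
    (J : Type u) : AddClass (S := S) M (J →₀ N) := by
  rw [addClass_iff] at hN ⊢
  obtain ⟨I, j, q, hq⟩ := hN
  refine ⟨J × I, (Finsupp.curryLinearEquiv S).symm.toLinearMap ∘ₗ Finsupp.mapRange.linearMap j,
    Finsupp.mapRange.linearMap q ∘ₗ (Finsupp.curryLinearEquiv S).toLinearMap, fun x => ?_⟩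
  ext t
  simp [hq]

open DirectSum in
theorem AddClass.directSum {I : Type u} [DecidableEq I] {G : I → Type u}
    [∀ i, AddCommGroup (G i)] [∀ i, Module S (G i)] (hG : ∀ i, AddClass (S := S) M (G i)) :
    AddClass (S := S) M (⨁ i, G i) := by
  simp only [addClass_iff] at hG
  choose J j q hq using hG
  rw [addClass_iff]
  refine ⟨Σ i, J i, DirectSum.toModule S I _ fun i => Finsupp.lmapDomain M S (Sigma.mk i) ∘ₗ j i,
    Finsupp.lsum ℕ fun t => DirectSum.lof S I G t.1 ∘ₗ q t.1 ∘ₗ Finsupp.lsingle t.2, ?_⟩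
  have key : ∀ i, (Finsupp.lsum ℕ fun t : Σ i, J i =>
      DirectSum.lof S I G t.1 ∘ₗ q t.1 ∘ₗ Finsupp.lsingle t.2) ∘ₗ
        Finsupp.lmapDomain M S (Sigma.mk i) = DirectSum.lof S I G i ∘ₗ q i := fun i => by
    refine Finsupp.lhom_ext' fun a => LinearMap.ext fun m => ?_
    simp
  intro x
  induction x using DirectSum.induction_on with
  | zero => simp
  | of i x =>
    have h := LinearMap.congr_fun (key i) (j i x)
    rw [← DirectSum.lof_eq_of S, DirectSum.toModule_lof]
    simpa [hq] using h
  | add x y hx hy => rw [map_add, map_add, hx, hy]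

/-! ### Closure under direct limits -/

/-- Relative complements `H t` of `⨆ s < t, k s` in `k t` form a local direct summand with the same
supremum as the chain. The assumption on initial suprema is removed by transfinite induction in the
next theorem. -/
theorem HasPerfectDecomposition.isComplemented_iSup_aux (hM : HasPerfectDecomposition S M)
    {N : Type u} [AddCommGroup N] [Module S N] (hN : AddClass (S := S) M N) {T : Type u}
    [LinearOrder T] [WellFoundedLT T] {k : T → Submodule S N} (hk : Monotone k)
    (hc : ∀ t, IsComplemented (k t)) (hc' : ∀ t, IsComplemented (⨆ s < t, k s)) :
    IsComplemented (⨆ t, k t) := by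
  have hle : ∀ t, ⨆ s < t, k s ≤ k t := fun t => iSup₂_le fun s hs => hk hs.le
  have hH : ∀ t, ∃ H, H ≤ k t ∧ Disjoint (⨆ s < t, k s) H ∧ (⨆ s < t, k s) ⊔ H = k t := fun t => by
    obtain ⟨W, hW⟩ := hc' t
    refine ⟨W ⊓ k t, inf_le_right, hW.disjoint.mono_right inf_le_left, ?_⟩
    rw [← sup_inf_assoc_of_le W (hle t), hW.sup_eq_top, top_inf_eq]
  choose H hHk hHd hHs using hH
  have hfin : ∀ J : Finset T, J.SupIndep H ∧ IsComplemented (⨆ t ∈ J, H t) := fun J => by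
    induction J using Finset.induction_on_max with
    | empty => exact ⟨Finset.supIndep_empty _, by simpa using isComplemented_bot⟩
    | insert a J hJ ih =>
      have hX : ⨆ t ∈ J, H t ≤ ⨆ s < a, k s :=
        iSup₂_le fun t ht => (hHk t).trans (le_iSup₂_of_le t (hJ t ht) le_rfl)
      refine ⟨ih.1.insert ?_, ?_⟩
      · rw [Finset.sup_eq_iSup]
        exact ((hHd a).mono_left hX).symm
      · rw [Finset.iSup_insert, sup_comm]
        exact ih.2.sup_of_le hX (hHd a) (by rw [hHs]; exact hc a)
  have hsup : ⨆ t, k t = ⨆ t, H t := by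
    refine le_antisymm (iSup_le fun t => ?_) (iSup_mono hHk)
    induction t using WellFoundedLT.induction with
    | ind t ih =>
      rw [← hHs t]
      exact sup_le (iSup₂_le ih) (le_iSup H t)
  rw [hsup]
  exact hM N hN T H ⟨iSupIndep_iff_supIndep.2 fun J => (hfin J).1, fun J => (hfin J).2⟩

theorem HasPerfectDecomposition.isComplemented_iSup (hM : HasPerfectDecomposition S M)
    {N : Type u} [AddCommGroup N] [Module S N] (hN : AddClass (S := S) M N) {T : Type u}
    [LinearOrder T] [WellFoundedLT T] {k : T → Submodule S N} (hk : Monotone k)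
    (hc : ∀ t, IsComplemented (k t)) : IsComplemented (⨆ t, k t) := by
  refine hM.isComplemented_iSup_aux hN hk hc fun t => ?_
  induction t using WellFoundedLT.induction with
  | ind t ih =>
    rw [show ⨆ s < t, k s = ⨆ s : Iio t, k s from (iSup_subtype'' (Iio t) k).symm]
    refine hM.isComplemented_iSup_aux hN (T := Iio t) (fun a b hab => hk hab) (fun a => hc a)
      fun a => ?_
    have : ⨆ s < a, k s.1 = ⨆ s < a.1, k s := by
      refine le_antisymm (iSup₂_le fun s hs => le_iSup₂_of_le s.1 hs le_rfl)
        (iSup₂_le fun s hs => le_iSup₂_of_le (⟨s, lt_trans hs a.2⟩ : Iio t) hs le_rfl)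
    rw [this]
    exact ih a.1 a.2

/-- A quotient by a direct summand is a retract. -/
theorem AddClass.of_surjective {N L : Type u} [AddCommGroup N] [Module S N] [AddCommGroup L]
    [Module S L] (hN : AddClass (S := S) M N) (q : N →ₗ[S] L) (hq : Function.Surjective q)
    (hker : IsComplemented (LinearMap.ker q)) : AddClass (S := S) M L := by
  obtain ⟨p, hp, hp'⟩ := Submodule.isComplemented_iff_exists_proj.1 hker
  let s : (N ⧸ LinearMap.ker q) →ₗ[S] N := (LinearMap.ker q).liftQ (LinearMap.id - p) fun x hx => by
    simp [hp' x hx]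
  refine hN.of_retract (s ∘ₗ (q.quotKerEquivOfSurjective hq).symm) q fun x => ?_
  obtain ⟨x, rfl⟩ := hq x
  have h1 : (q.quotKerEquivOfSurjective hq).symm (q x) = Submodule.Quotient.mk x := by
    rw [LinearEquiv.symm_apply_eq]; rfl
  have h2 : q (p x) = 0 := hp x
  simp [h1, s, h2]

open DirectSum in
theorem HasPerfectDecomposition.closedUnderDirectLimits (hM : HasPerfectDecomposition S M) :
    ClosedUnderDirectLimits (AddClass (S := S) M) := by
  classical
  rintro L _ _ ⟨I, _, _, _, G, _, _, f, _, hG, ⟨e⟩⟩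
  let q : (⨁ i, G i) →ₗ[S] Module.DirectLimit G f :=
    DirectSum.toModule S I _ fun i => Module.DirectLimit.of S I G f i
  have hN : AddClass (S := S) M (⨁ i, G i) := AddClass.directSum hG
  have hqs : Function.Surjective q := fun z => by
    obtain ⟨i, x, rfl⟩ := Module.DirectLimit.exists_of z
    exact ⟨DirectSum.lof S I G i x, by simp [q]⟩
  -- the projection onto the kernel of the map from the part below `i` to `G i`
  let t : I → (⨁ i, G i) →ₗ[S] (⨁ i, G i) := fun i => DirectSum.toModule S I _ fun j =>
    if h : j ≤ i then DirectSum.lof S I G j - DirectSum.lof S I G i ∘ₗ f j i h else 0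
  have ht : ∀ {i j} (h : j ≤ i) (x : G j), t i (DirectSum.lof S I G j x) =
      DirectSum.lof S I G j x - DirectSum.lof S I G i (f j i h x) := fun {i j} h x => by
    simp [t, h]
  have ht' : ∀ {i j} (_ : ¬ j ≤ i) (x : G j), t i (DirectSum.lof S I G j x) = 0 :=
    fun {i j} h x => by simp [t, h]
  have hff : ∀ {i j k} (hij : i ≤ j) (hjk : j ≤ k) (x : G i),
      f j k hjk (f i j hij x) = f i k (hij.trans hjk) x := fun hij hjk x =>
    DirectedSystem.map_map (f := fun i j h => f i j h) hij hjk x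
  have hfi : ∀ {i} (x : G i), f i i le_rfl x = x := fun {i} x =>
    DirectedSystem.map_self (f := fun i j h => f i j h) x
  -- This gives both that each `t i` is idempotent and that the ranges increase with `i`.
  have htt : ∀ {i i'} (h : i ≤ i') x, t i' (t i x) = t i x := by
    intro i i' h x
    induction x using DirectSum.induction_on with
    | zero => simp
    | add x y hx hy => rw [map_add, map_add, hx, hy]
    | of j x =>
      rw [← DirectSum.lof_eq_of S]
      by_cases hj : j ≤ i
      · rw [ht hj, map_sub, ht (hj.trans h), ht h, hff]
        abel
      · rw [ht' hj, map_zero]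
  have htq : ∀ i x, q (t i x) = 0 := by
    intro i x
    induction x using DirectSum.induction_on with
    | zero => simp
    | add x y hx hy => rw [map_add, map_add, hx, hy, add_zero]
    | of j x =>
      rw [← DirectSum.lof_eq_of S]
      by_cases hj : j ≤ i
      · simp [ht hj, q]
      · rw [ht' hj, map_zero]
  have hrest : ∀ x, ∃ i₀, ∀ i, i₀ ≤ i → ∃ y, x = t i x + DirectSum.lof S I G i y := by
    intro x
    induction x using DirectSum.induction_on with
    | zero => exact ⟨Classical.arbitrary I, fun i _ => ⟨0, by simp⟩⟩
    | add x y hx hy =>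
      obtain ⟨a, ha⟩ := hx
      obtain ⟨b, hb⟩ := hy
      obtain ⟨c, hac, hbc⟩ := exists_ge_ge a b
      refine ⟨c, fun i hi => ?_⟩
      obtain ⟨y₁, h₁⟩ := ha i (hac.trans hi)
      obtain ⟨y₂, h₂⟩ := hb i (hbc.trans hi)
      refine ⟨y₁ + y₂, ?_⟩
      rw [map_add, map_add]
      nth_rewrite 1 [h₁, h₂]
      abel
    | of j x =>
      rw [← DirectSum.lof_eq_of S]
      exact ⟨j, fun i hi => ⟨f j i hi x, by rw [ht hi]; abel⟩⟩
  have hmono : Monotone fun i => LinearMap.range (t i) := fun i i' h => by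
    rintro _ ⟨x, rfl⟩
    exact ⟨t i x, htt h x⟩
  have hker : LinearMap.ker q = sSup (range fun i => LinearMap.range (t i)) := by
    refine le_antisymm (fun x hx => ?_) (sSup_le ?_)
    · obtain ⟨i, hi⟩ := hrest x
      obtain ⟨y, hy⟩ := hi i le_rfl
      have h1 : Module.DirectLimit.of S I G f i y = 0 := by
        have : q x = 0 := hx
        rw [hy, map_add, htq, zero_add] at this
        simpa [q] using this
      -- What dies in the limit already dies at some stage `j`, and is then fixed by `t j`.
      obtain ⟨j, hij, hj⟩ := Module.DirectLimit.of.zero_exact h1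
      have h2 : DirectSum.lof S I G i y = t j (DirectSum.lof S I G i y) := by
        rw [ht hij, hj, map_zero, sub_zero]
      rw [hy, h2]
      exact add_mem (SetLike.le_def.1 (le_sSup (mem_range_self i)) ⟨_, rfl⟩)
        (SetLike.le_def.1 (le_sSup (mem_range_self j)) ⟨_, rfl⟩)
    · rintro _ ⟨i, rfl⟩ _ ⟨x, rfl⟩
      exact htq i x
  refine AddClass.of_surjective hN (e.symm.toLinearMap ∘ₗ q) (e.symm.surjective.comp hqs) ?_
  rw [LinearEquiv.ker_comp, hker]
  refine sSup_mem_of_directedOn (K := {K | IsComplemented K})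
    (fun T _ _ _ k hk hc => hM.isComplemented_iSup hN hk hc) ?_ (range_nonempty _)
    (directedOn_range.2 hmono.directed_le)
  rintro _ ⟨i, rfl⟩
  refine Submodule.isComplemented_iff_exists_proj.2 ⟨t i, fun x => ⟨x, rfl⟩, ?_⟩
  rintro _ ⟨x, rfl⟩
  exact htt le_rfl x

end

section

variable {S : Type u} [Ring S]

/-! ### Minimal failures of perfect decomposition -/

theorem IsLocalDirectSummand.comp {N : Type u} [AddCommGroup N] [Module S N] {I J : Type u}
    {P : I → Submodule S N} (hP : IsLocalDirectSummand P) {f : J → I} (hf : Function.Injective f) :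
    IsLocalDirectSummand (P ∘ f) := by
  classical
  refine ⟨hP.iSupIndep.comp hf, fun s => ?_⟩
  have := hP.isComplemented (s.image f)
  rwa [Finset.iSup_finset_image] at this

variable {M : Type u} [AddCommGroup M] [Module S M]

/-- Take a non-split local direct summand of `N` with index set of least cardinality `c`. Finite
families split by definition, and shorter ones by minimality. -/
theorem exists_minimal_of_not_hasPerfectDecomposition (h : ¬ HasPerfectDecomposition S M) :
    ∃ (N : Type u) (_ : AddCommGroup N) (_ : Module S N) (c : Cardinal.{u})
      (B : c.ord.ToType → Submodule S N), AddClass (S := S) M N ∧ c.IsRegular ∧ iSupIndep B ∧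
      (∀ i, IsComplemented (B i)) ∧ (∀ a, IsComplemented (⨆ i < a, B i)) ∧
      ¬ IsComplemented (⨆ i, B i) := by
  unfold HasPerfectDecomposition at h
  push Not at h
  obtain ⟨N, _, _, hN, I₀, P₀, hP₀, hnot₀⟩ := h
  let C : Set Cardinal.{u} := {c | ∃ (I : Type u) (P : I → Submodule S N), #I = c ∧
    IsLocalDirectSummand P ∧ ¬ IsComplemented (⨆ i, P i)}
  have hC : C.Nonempty := ⟨_, I₀, P₀, rfl, hP₀, hnot₀⟩
  let c := sInf C
  have hmin : ∀ (I : Type u) (P : I → Submodule S N), IsLocalDirectSummand P → #I < c →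
      IsComplemented (⨆ i, P i) := fun I P hP hI => by
    by_contra hcon
    exact notMem_of_lt_csInf' hI ⟨I, P, rfl, hP, hcon⟩
  obtain ⟨I, P, hI, hP, hnot⟩ : c ∈ C := csInf_mem hC
  have hinf : ℵ₀ ≤ c := by
    by_contra hcon
    rw [not_le, ← hI, lt_aleph0_iff_finite] at hcon
    have := Fintype.ofFinite I
    exact hnot (by simpa using hP.isComplemented Finset.univ)
  obtain ⟨e⟩ : Nonempty (c.ord.ToType ≃ I) := Cardinal.eq.1 (by simp [hI])
  let B : c.ord.ToType → Submodule S N := P ∘ e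
  have hB : IsLocalDirectSummand B := hP.comp e.injective
  have hBnot : ¬ IsComplemented (⨆ i, B i) := by
    rwa [show ⨆ i, B i = ⨆ i, P i from e.iSup_comp]
  have hsmall : ∀ U : Set c.ord.ToType, #U < c → IsComplemented (⨆ i ∈ U, B i) := fun U hU => by
    rw [← iSup_subtype'' U B]
    exact hmin U _ (hB.comp Subtype.val_injective) hU
  have hIic : ∀ a : c.ord.ToType, #(Iic a) < c := fun a => by
    rw [← Iio_insert]
    refine mk_insert_le.trans_lt (add_lt_of_lt hinf ?_ (one_lt_aleph0.trans_le hinf))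
    exact (mk_Iio_lt a (by simp)).trans_eq (by simp)
  refine ⟨N, inferInstance, inferInstance, c, B, hN, ⟨hinf, ?_⟩, hB.iSupIndep, fun i => ?_,
    fun a => ?_, hBnot⟩
  -- If `c` were singular, grouping the `B t` along a cofinal set of size below `c` would give a
  -- shorter family with the same sum. Finitely many groups involve only indices in a proper initial
  -- segment, so their sum splits and the shorter family is again a local direct summand.
  · by_contra hcof
    rw [not_le] at hcof
    obtain ⟨s, hs, hsc⟩ := Order.exists_cof_eq c.ord.ToType
    rw [Ordinal.cof_toType] at hsc
    have hj : ∀ t, ∃ a : s, t ≤ a.1 := fun t => by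
      obtain ⟨a, ha, hta⟩ := hs t
      exact ⟨⟨a, ha⟩, hta⟩
    choose j hj using hj
    let Q : s → Submodule S N := fun a => ⨆ t ∈ {t | j t = a}, B t
    have hQ : ⨆ a, Q a = ⨆ t, B t :=
      le_antisymm (iSup_le fun a => iSup₂_le fun t _ => le_iSup B t)
        (iSup_le fun t => le_iSup_of_le (j t) (le_iSup₂_of_le t rfl le_rfl))
    refine hBnot (hQ ▸ hmin s Q ⟨fun a => ?_, fun J => ?_⟩ (hsc.trans_lt hcof))
    · have h1 : ⨆ b, ⨆ (_ : b ≠ a), Q b ≤ ⨆ t ∈ {t | j t = a}ᶜ, B t :=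
        iSup₂_le fun b hb => iSup₂_le fun t ht => le_iSup₂_of_le t (fun h => hb (ht.symm.trans h)) le_rfl
      exact (hB.iSupIndep.disjoint_biSup_biSup disjoint_compl_right).mono_right h1
    · have h1 : ⨆ a ∈ J, Q a = ⨆ t ∈ {t | j t ∈ J}, B t :=
        le_antisymm (iSup₂_le fun a ha => iSup₂_le fun t ht => le_iSup₂_of_le t (by
            rw [mem_ofPred_eq] at ht ⊢; rwa [ht]) le_rfl)
          (iSup₂_le fun t ht => le_iSup₂_of_le (j t) ht (le_iSup₂_of_le t rfl le_rfl))
      rw [h1]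
      refine hsmall _ ?_
      rcases J.eq_empty_or_nonempty with rfl | hJ
      · simpa using (aleph0_pos.trans_le hinf)
      · refine (mk_le_mk_of_subset ?_).trans_lt (hIic (J.max' hJ).1)
        exact fun t ht => (hj t).trans (J.le_max' _ ht)
  · simpa using hB.isComplemented {i}
  · exact hsmall (Iio a) ((mk_Iio_lt a (by simp)).trans_eq (by simp))

/-! ### Directed unions -/

theorem Submodule.nonempty_equiv_directLimit {X : Type u} [AddCommGroup X] [Module S X] {Ω : Type u}
    [PartialOrder Ω] [Nonempty Ω] [IsDirectedOrder Ω] [DecidableEq Ω] (F : Ω → Submodule S X)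
    (hF : Monotone F) (htop : ∀ x, ∃ α, x ∈ F α) :
    Nonempty (X ≃ₗ[S] Module.DirectLimit (fun α => F α) fun _ _ h => Submodule.inclusion (hF h)) := by
  refine ⟨LinearEquiv.symm (LinearEquiv.ofBijective
      (Module.DirectLimit.lift S Ω (fun α => F α) (fun _ _ h => Submodule.inclusion (hF h))
        (fun α => (F α).subtype) fun _ _ _ _ => rfl) ⟨?_, fun x => ?_⟩)⟩
  · exact Module.DirectLimit.lift_injective _ _ fun α => Subtype.val_injective
  · obtain ⟨α, hα⟩ := htop x
    exact ⟨Module.DirectLimit.of S Ω _ _ α ⟨x, hα⟩,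
      Module.DirectLimit.lift_of _ _ _⟩

theorem DirLimClass.of_directed_iSup {𝒞 : ModuleClass S} {X : Type u} [AddCommGroup X] [Module S X]
    {Ω : Type u} [PartialOrder Ω] [Nonempty Ω] [IsDirectedOrder Ω] (F : Ω → Submodule S X)
    (hF : Monotone F) (htop : ∀ x, ∃ α, x ∈ F α) (h𝒞 : ∀ α, 𝒞 (F α)) : DirLimClass 𝒞 X := by
  classical
  exact ⟨Ω, _, inferInstance, inferInstance, fun α => F α, _, _,
    fun _ _ h => Submodule.inclusion (hF h), ⟨fun i x => rfl, fun i j k hij hjk x => rfl⟩, h𝒞,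
    Submodule.nonempty_equiv_directLimit F hF htop⟩

end

section

variable {S : Type u} [Ring S]

/-! ### Gluing along ladders -/

theorem iSupIndep.exists_linearMap {N T Z : Type u} [AddCommGroup N] [Module S N] [AddCommGroup Z]
    [Module S Z] {B : T → Submodule S N} (hB : iSupIndep B) (y : T → N →ₗ[S] Z) :
    ∃ G : (⨆ i, B i : Submodule S N) →ₗ[S] Z, ∀ i (b : N) (_ : b ∈ B i) (hb' : b ∈ ⨆ i, B i),
      G ⟨b, hb'⟩ = y i b := by
  classical
  let e := LinearEquiv.ofInjective _ hB.dfinsupp_lsum_injective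
  let e' := LinearEquiv.ofEq _ _ (Submodule.iSup_eq_range_dfinsupp_lsum B)
  refine ⟨(DFinsupp.lsum ℕ fun i => y i ∘ₗ (B i).subtype) ∘ₗ e.symm.toLinearMap ∘ₗ e'.toLinearMap,
    fun i b hb hb' => ?_⟩
  have : e.symm (e' ⟨b, hb'⟩) = DFinsupp.single i ⟨b, hb⟩ := by
    rw [LinearEquiv.symm_apply_eq]
    apply Subtype.ext
    simp [e, e']
  simp [this]

theorem LinearMap.exists_factor {A C Z : Type u} [AddCommGroup A] [Module S A] [AddCommGroup C]
    [Module S C] [AddCommGroup Z] [Module S Z] (q : A →ₗ[S] C) (hq : Function.Surjective q)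
    (f : A →ₗ[S] Z) (h : ∀ x, q x = 0 → f x = 0) : ∃ f' : C →ₗ[S] Z, ∀ x, f' (q x) = f x := by
  refine ⟨(LinearMap.ker q).liftQ f h ∘ₗ (q.quotKerEquivOfSurjective hq).symm, fun x => ?_⟩
  have h1 : (q.quotKerEquivOfSurjective hq).symm (q x) = Submodule.Quotient.mk x := by
    rw [LinearEquiv.symm_apply_eq]; rfl
  rw [LinearMap.comp_apply, LinearEquiv.coe_coe, h1]
  exact Submodule.liftQ_apply _ _ _

/-- An independent family `B` of submodules of `N` indexed by `T`, with a projection onto each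
member and onto each initial partial sum, and ladders `η δ` of type `T` below the elements `δ` of a
subset `E` of `Ω`. -/
structure LadderDatum (S : Type u) [Ring S] (N T Ω : Type u) [AddCommGroup N] [Module S N]
    [LinearOrder T] [LinearOrder Ω] where
  B : T → Submodule S N
  indep : iSupIndep B
  p : T → N →ₗ[S] N
  p_mem : ∀ i x, p i x ∈ B i
  p_eq : ∀ i, ∀ x ∈ B i, p i x = x
  π : T → N →ₗ[S] N
  π_mem : ∀ a x, π a x ∈ ⨆ i < a, B i
  π_eq : ∀ a, ∀ i < a, ∀ x ∈ B i, π a x = x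
  E : Set Ω
  η : Ω → T → Ω
  η_strictMono : ∀ δ ∈ E, StrictMono (η δ)
  η_lt : ∀ δ ∈ E, ∀ i, η δ i < δ

namespace LadderDatum

variable {N T Ω : Type u} [AddCommGroup N] [Module S N] [LinearOrder T] [LinearOrder Ω]
  (D : LadderDatum S N T Ω)

/-- The sum of the independent family. -/
def total : Submodule S N := ⨆ i, D.B i

theorem le_total (i : T) : D.B i ≤ D.total := le_iSup D.B i

theorem π_mem_total (a : T) (x : N) : D.π a x ∈ D.total :=
  (iSup₂_le fun i _ => D.le_total i : ⨆ i < a, D.B i ≤ D.total) (D.π_mem a x)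

/-- The projection onto an initial partial sum, as a map to the total sum. -/
def πTotal (a : T) : N →ₗ[S] D.total := (D.π a).codRestrict D.total (D.π_mem_total a)

section glue

variable {Z : Type u} [AddCommGroup Z] [Module S Z]

/-- The map on the total sum given by `y i` on `B i`. -/
noncomputable def glue (y : T → N →ₗ[S] Z) : D.total →ₗ[S] Z :=
  (D.indep.exists_linearMap y).choose

theorem glue_apply (y : T → N →ₗ[S] Z) {i : T} {b : D.total} (hb : b.1 ∈ D.B i) :
    D.glue y b = y i b :=
  (D.indep.exists_linearMap y).choose_spec i b hb b.2

theorem eq_zero_of_forall {G : D.total →ₗ[S] Z} (h : ∀ i (b : D.total), b.1 ∈ D.B i → G b = 0)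
    (b : D.total) : G b = 0 := by
  have : D.total ≤ (LinearMap.ker G).map D.total.subtype :=
    iSup_le fun i x hx => ⟨⟨x, D.le_total i hx⟩, h i _ hx, rfl⟩
  obtain ⟨c, hc, hcb⟩ := this b.2
  rwa [← Subtype.ext (a1 := c) (a2 := b) hcb]

theorem eq_zero_of_forall_lt {G : D.total →ₗ[S] Z} {a : T}
    (h : ∀ i < a, ∀ b : D.total, b.1 ∈ D.B i → G b = 0) (n : N) : G (D.πTotal a n) = 0 := by
  have : ⨆ i < a, D.B i ≤ (LinearMap.ker G).map D.total.subtype :=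
    iSup₂_le fun i hi x hx => ⟨⟨x, D.le_total i hx⟩, h i hi _ hx, rfl⟩
  obtain ⟨c, hc, hcb⟩ := this (D.π_mem a n)
  rwa [← Subtype.ext (a1 := c) (a2 := D.πTotal a n) hcb]

end glue

/-- The free module on the generators of `LadderDatum.Glued`. -/
abbrev Free : Type u := (Ω ⊕ D.E) →₀ N

/-- The map whose vanishing identifies `B i`, inside the copy of `N` at `δ`, with `B i` inside the
copy of `N` at `η δ i`. -/
noncomputable def rel (δ : D.E) : D.total →ₗ[S] D.Free :=
  D.glue (fun i => Finsupp.lsingle (Sum.inl (D.η δ i))) -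
    Finsupp.lsingle (Sum.inr δ) ∘ₗ D.total.subtype

theorem rel_apply (δ : D.E) {i : T} {b : D.total} (hb : b.1 ∈ D.B i) :
    D.rel δ b = Finsupp.single (Sum.inl (D.η δ i)) b.1 - Finsupp.single (Sum.inr δ) b.1 := by
  simp [rel, D.glue_apply _ hb]

theorem rel_apply_inr (δ δ' : D.E) (b : D.total) :
    D.rel δ b (Sum.inr δ') = - Finsupp.single δ b.1 δ' := by
  classical
  have h : ∀ b, ((Finsupp.lapply (Sum.inr δ') : D.Free →ₗ[S] N) ∘ₗ
      D.glue (fun i => Finsupp.lsingle (Sum.inl (D.η δ i)))) b = 0 :=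
    D.eq_zero_of_forall fun i b hb => by simp [D.glue_apply _ hb]
  have h' := h b
  rw [LinearMap.comp_apply, Finsupp.lapply_apply] at h'
  simp [rel, h', Finsupp.single_apply]

/-- All relations. -/
noncomputable def relMap : (D.E →₀ D.total) →ₗ[S] D.Free := Finsupp.lsum ℕ D.rel

theorem relMap_apply_inr (b : D.E →₀ D.total) (δ : D.E) : D.relMap b (Sum.inr δ) = - (b δ).1 := by
  classical
  induction b using Finsupp.induction_linear with
  | zero => simp
  | add f g hf hg => rw [map_add, Finsupp.add_apply, hf, hg, Finsupp.add_apply, Submodule.coe_add]; abel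
  | single δ' b =>
    simp only [relMap, Finsupp.lsum_single, rel_apply_inr, Finsupp.single_apply]
    split_ifs <;> simp

/-- The module obtained from `Ω` copies of `N` by gluing on further copies of `N`, one for each
`δ ∈ E`, along the embedding of `⨁ B i` given by the ladder at `δ`. -/
abbrev Glued : Type u := D.Free ⧸ LinearMap.range D.relMap

/-- The quotient map. -/
noncomputable def proj : D.Free →ₗ[S] D.Glued := (LinearMap.range D.relMap).mkQ

theorem proj_rel (δ : D.E) (b : D.total) : D.proj (D.rel δ b) = 0 :=
  (Submodule.Quotient.mk_eq_zero _).2 ⟨Finsupp.single δ b, by simp [relMap]⟩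

theorem proj_single_inl (δ : D.E) {i : T} {b : N} (hb : b ∈ D.B i) :
    D.proj (Finsupp.single (Sum.inl (D.η δ i)) b) = D.proj (Finsupp.single (Sum.inr δ) b) := by
  have := D.proj_rel δ ⟨b, D.le_total i hb⟩
  rwa [D.rel_apply δ hb, map_sub, sub_eq_zero] at this

/-- The position of a generator in `Ω`. -/
def pos : Ω ⊕ D.E → Ω := Sum.elim id Subtype.val

/-- The elements of the free module supported below `α`. -/
def freeBelow (α : Ω) : Submodule S D.Free := Finsupp.supported N S {t | D.pos t < α}

/-- The part of the glued module below `α`. -/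
noncomputable def below (α : Ω) : Submodule S D.Glued := (D.freeBelow α).map D.proj

theorem below_mono : Monotone D.below := fun _ _ h =>
  Submodule.map_mono (Finsupp.supported_mono fun _ ht => lt_of_lt_of_le ht h)

theorem proj_single_mem_below {t : Ω ⊕ D.E} {α : Ω} (ht : D.pos t < α) (n : N) :
    D.proj (Finsupp.single t n) ∈ D.below α :=
  ⟨_, Finsupp.single_mem_supported S n ht, rfl⟩

theorem below_le {α : Ω} {K : Submodule S D.Glued}
    (h : ∀ t, D.pos t < α → ∀ n, D.proj (Finsupp.single t n) ∈ K) : D.below α ≤ K := by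
  rintro _ ⟨w, hw, rfl⟩
  have hw' : ∀ t ∈ w.support, D.pos t < α := fun t ht => hw ht
  rw [← Finsupp.sum_single w, Finsupp.sum, map_sum]
  exact sum_mem fun t ht => h t (hw' t ht) _

theorem exists_mem_below [Nonempty Ω] [NoMaxOrder Ω] (x : D.Glued) : ∃ α, x ∈ D.below α := by
  obtain ⟨w, rfl⟩ := Submodule.mkQ_surjective _ x
  induction w using Finsupp.induction_linear with
  | zero => exact ⟨Classical.arbitrary Ω, by simp⟩
  | add f g hf hg =>
    obtain ⟨a, ha⟩ := hf
    obtain ⟨b, hb⟩ := hg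
    refine ⟨max a b, ?_⟩
    rw [map_add]
    exact add_mem (D.below_mono (le_max_left a b) ha) (D.below_mono (le_max_right a b) hb)
  | single t n =>
    obtain ⟨α, hα⟩ := exists_gt (D.pos t)
    exact ⟨α, D.proj_single_mem_below hα n⟩

/-- The copy of `N` at `δ` occurs only in the relation at `δ`, with coefficient readable from that
coordinate. So a combination of relations supported below `α` uses only relations at points `δ < α`.
-/
theorem eq_zero_of_proj_eq_zero {Z : Type u} [AddCommGroup Z] [Module S Z] {Ψ : D.Free →ₗ[S] Z}
    {α : Ω} (hΨ : ∀ δ : D.E, δ.1 < α → ∀ b, Ψ (D.rel δ b) = 0) {w : D.Free}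
    (hw : w ∈ D.freeBelow α) (h : D.proj w = 0) : Ψ w = 0 := by
  obtain ⟨b, rfl⟩ := (Submodule.Quotient.mk_eq_zero _).1 h
  have hb : ∀ δ : D.E, ¬ δ.1 < α → b δ = 0 := fun δ hδ => by
    by_contra hne
    refine hδ (hw (a := Sum.inr δ) ?_)
    rw [Finset.mem_coe, Finsupp.mem_support_iff, relMap_apply_inr]
    simpa using hne
  rw [relMap, Finsupp.lsum_apply, Finsupp.sum, map_sum]
  refine Finset.sum_eq_zero fun δ _ => ?_
  by_cases hδ : δ.1 < α
  · exact hΨ δ hδ _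
  · rw [hb δ hδ, map_zero, map_zero]

theorem exists_desc {Z : Type u} [AddCommGroup Z] [Module S Z] (Ψ : D.Free →ₗ[S] Z) {α : Ω}
    (hΨ : ∀ δ : D.E, δ.1 < α → ∀ b, Ψ (D.rel δ b) = 0) :
    ∃ f : D.below α →ₗ[S] Z, ∀ w (hw : w ∈ D.freeBelow α), f ⟨D.proj w, w, hw, rfl⟩ = Ψ w := by
  obtain ⟨f, hf⟩ := (D.proj.submoduleMap (D.freeBelow α)).exists_factor
    (D.proj.submoduleMap_surjective _) (Ψ ∘ₗ (D.freeBelow α).subtype) fun w hw =>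
      D.eq_zero_of_proj_eq_zero hΨ w.2 (congrArg Subtype.val hw)
  exact ⟨f, fun w hw => hf ⟨w, hw⟩⟩

/-- `g` cuts off the ladders below `α` so that the remaining tails are disjoint. -/
def IsFreeBelow (α : Ω) (g : Ω → T) : Prop :=
  ∀ δ ∈ D.E, δ < α → ∀ δ' ∈ D.E, δ' < α → δ ≠ δ' →
    ∀ i, g δ ≤ i → ∀ i', g δ' ≤ i' → D.η δ i ≠ D.η δ' i'

/-! ### Coherent maps by recursion along the ladders -/

section recursion

variable {Z : Type u} [AddCommGroup Z] [Module S Z]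

open Classical in
/-- Recursive construction of maps out of the glued module. -/
theorem exists_coherent [WellFoundedLT Ω] {α : Ω} {g : Ω → T} (hg : D.IsFreeBelow α g)
    (v : D.E → N →ₗ[S] Z) (z₀ : Ω → N →ₗ[S] Z) :
    ∃ (z : Ω → N →ₗ[S] Z) (w : D.E → N →ₗ[S] Z),
      (∀ δ n, w δ n = v δ (n - D.π (g δ) n) +
        D.glue (fun j => if j < g δ then z (D.η δ j) else 0) (D.πTotal (g δ) n)) ∧
      (∀ δ : D.E, δ.1 < α → ∀ i, g δ ≤ i → ∀ n,
        z (D.η δ i) n = w δ (D.p i n) + z₀ (D.η δ i) (n - D.p i n)) ∧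
      ∀ ξ, (∀ δ : D.E, δ.1 < α → ∀ i, g δ ≤ i → D.η δ i ≠ ξ) → z ξ = z₀ ξ := by
  -- On the copy at `δ`, the head of the ladder (indices below `g δ`) prescribes the values on the
  -- image of the projection `π (g δ)`; on the complement `v δ` is used.
  let V : D.E → (T → N →ₗ[S] Z) → N →ₗ[S] Z := fun δ y =>
    v δ ∘ₗ (LinearMap.id - D.π (g δ)) + D.glue y ∘ₗ D.πTotal (g δ)
  let own : Ω → D.E × T → Prop := fun ξ q => q.1.1 < α ∧ g q.1 ≤ q.2 ∧ D.η q.1 q.2 = ξ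
  -- A point `ξ` lies in at most one tail, by freeness. If `ξ = η δ i` with `g δ ≤ i`, the value on
  -- `B i` is forced by the copy at `δ`, which depends only on the head and hence on points below
  -- `ξ`; elsewhere `z₀` is used.
  let F : ∀ ξ : Ω, (∀ ξ' : Ω, ξ' < ξ → N →ₗ[S] Z) → N →ₗ[S] Z := fun ξ ih =>
    if h : ∃ q, own ξ q then
      V h.choose.1 (fun j => if hj : j < g h.choose.1 ∧ D.η h.choose.1 j < ξ then ih _ hj.2 else 0)
        ∘ₗ D.p h.choose.2 + z₀ ξ ∘ₗ (LinearMap.id - D.p h.choose.2)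
    else z₀ ξ
  let z : Ω → N →ₗ[S] Z := WellFoundedLT.fix F
  have hz : ∀ ξ, z ξ = F ξ fun ξ' _ => z ξ' := fun ξ => WellFoundedLT.fix_eq _ ξ
  refine ⟨z, fun δ => V δ fun j => if j < g δ then z (D.η δ j) else 0, fun δ n => by simp [V],
    fun δ hδ i hi n => ?_, fun ξ hξ => ?_⟩
  · have h : ∃ q, own (D.η δ i) q := ⟨(δ, i), hδ, hi, rfl⟩
    have hq : h.choose = (δ, i) := by
      obtain ⟨h1, h2, h3⟩ := h.choose_spec
      have h4 : h.choose.1 = δ := by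
        by_contra hne
        exact hg _ h.choose.1.2 h1 _ δ.2 hδ (fun h => hne (Subtype.ext h)) _ h2 _ hi h3
      refine Prod.ext h4 ?_
      rw [h4] at h3
      exact (D.η_strictMono _ δ.2).injective h3
    have h5 : (fun j => if j < g δ ∧ D.η δ j < D.η δ i then z (D.η δ j) else 0) =
        fun j => if j < g δ then z (D.η δ j) else 0 := by
      funext j
      by_cases hj : j < g δ
      · simp [hj, D.η_strictMono _ δ.2 (hj.trans_le hi)]
      · simp [hj]
    rw [hz]
    simp only [F, dif_pos h, hq, dite_eq_ite, h5]
    simp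
  · rw [hz]
    have : ¬ ∃ q, own ξ q := fun ⟨q, h1, h2, h3⟩ => hξ q.1 h1 q.2 h2 h3
    simp only [F, dif_neg this]

variable {D}

/-- The map on the free module given by coherent families vanishes on the relations. -/
theorem lsum_rel_eq_zero {α : Ω} {g : Ω → T} {v : D.E → N →ₗ[S] Z} {z₀ z : Ω → N →ₗ[S] Z}
    {w : D.E → N →ₗ[S] Z} {y : D.E → T → N →ₗ[S] Z} (hy : ∀ δ : D.E, ∀ j < g δ, y δ j = z (D.η δ j))
    (hw : ∀ δ n, w δ n = v δ (n - D.π (g δ) n) + D.glue (y δ) (D.πTotal (g δ) n))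
    (hz : ∀ δ : D.E, δ.1 < α → ∀ i, g δ ≤ i → ∀ n,
      z (D.η δ i) n = w δ (D.p i n) + z₀ (D.η δ i) (n - D.p i n))
    (δ : D.E) (hδ : δ.1 < α) (b : D.total) :
    Finsupp.lsum ℕ (Sum.elim z w) (D.rel δ b) = 0 := by
  refine D.eq_zero_of_forall (G := Finsupp.lsum ℕ (Sum.elim z w) ∘ₗ D.rel δ) (fun i b hb => ?_) b
  rw [LinearMap.comp_apply, D.rel_apply δ hb, map_sub, sub_eq_zero]
  simp only [Finsupp.lsum_single, Sum.elim_inl, Sum.elim_inr]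
  rcases lt_or_ge i (g δ) with hi | hi
  · have h1 : D.π (g δ) b.1 = b.1 := D.π_eq _ i hi _ hb
    have h2 : D.πTotal (g δ) b.1 = b := Subtype.ext h1
    rw [hw, h1, h2, sub_self, map_zero, zero_add, D.glue_apply _ hb, hy δ i hi]
  · rw [hz δ hδ i hi, D.p_eq i _ hb, sub_self, map_zero, add_zero]

end recursion

/-- Below a point at which the ladder system is free, the glued module is a retract of the free
module. -/
theorem below_mem_addClass [WellFoundedLT Ω] {M : Type u} [AddCommGroup M] [Module S M]
    (hN : AddClass (S := S) M N) {α : Ω} {g : Ω → T} (hg : D.IsFreeBelow α g) :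
    AddClass (S := S) M (D.below α) := by
  classical
  -- Starting from the tautological inclusions, the recursion corrects representatives in the free
  -- module so that the relations below `α` are killed while classes are unchanged. The induced map
  -- is a section of `Q`.
  obtain ⟨z, w, hw, hz, hz₀⟩ := D.exists_coherent hg (fun δ => Finsupp.lsingle (Sum.inr δ))
    fun ξ => Finsupp.lsingle (Sum.inl ξ)
  let Ψ : D.Free →ₗ[S] D.Free := Finsupp.lsum ℕ (Sum.elim z w)
  obtain ⟨f, hf⟩ := D.exists_desc Ψ (lsum_rel_eq_zero.{u} (y := fun δ j => if j < g δ then z (D.η δ j) else 0)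
    (z₀ := fun ξ => Finsupp.lsingle (Sum.inl ξ)) (fun δ j hj => if_pos hj) hw hz)
  let P : D.Free →ₗ[S] D.freeBelow α := Finsupp.restrictDom N S {t | D.pos t < α}
  have hP : ∀ {t}, D.pos t < α → ∀ n, (P (Finsupp.single t n) : D.Free) = Finsupp.single t n :=
    fun {t} ht n => by
      simp only [P]
      exact Finsupp.filter_single_of_pos _ ht
  let Q : D.Free →ₗ[S] D.below α := D.proj.submoduleMap (D.freeBelow α) ∘ₗ P
  have hQ : ∀ x, (Q x : D.Glued) = D.proj (P x) := fun x => rfl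
  have hstep : ∀ δ : D.E, δ.1 < α → (∀ j < g δ, ∀ n, (Q (z (D.η δ j) n) : D.Glued) =
      D.proj (Finsupp.single (Sum.inl (D.η δ j)) n)) →
      ∀ n, (Q (w δ n) : D.Glued) = D.proj (Finsupp.single (Sum.inr δ) n) := by
    intro δ hδ ih n
    have h1 := D.eq_zero_of_forall_lt (a := g δ)
      (G := (D.below α).subtype ∘ₗ Q ∘ₗ D.glue (fun j => if j < g δ then z (D.η δ j) else 0) -
        D.proj ∘ₗ Finsupp.lsingle (Sum.inr δ) ∘ₗ D.total.subtype) (fun i hi b hb => by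
        have h2 := ih i hi b
        have h3 := D.proj_single_inl δ hb
        simp [D.glue_apply _ hb, hi, h2, h3]) n
    have h4 : ((D.πTotal (g δ) n : D.total) : N) = D.π (g δ) n := rfl
    simp only [LinearMap.sub_apply, LinearMap.comp_apply, Submodule.subtype_apply, sub_eq_zero,
      Finsupp.lsingle_apply, h4] at h1
    rw [hw, map_add, Submodule.coe_add, h1, hQ, Finsupp.lsingle_apply, hP (t := Sum.inr δ) hδ, ← map_add,
      ← Finsupp.single_add, sub_add_cancel]
  have hzQ : ∀ ξ, ξ < α → ∀ n, (Q (z ξ n) : D.Glued) = D.proj (Finsupp.single (Sum.inl ξ) n) := by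
    intro ξ
    induction ξ using WellFoundedLT.induction with
    | ind ξ ih =>
      intro hξ n
      by_cases hown : ∃ δ : D.E, δ.1 < α ∧ ∃ i, g δ ≤ i ∧ D.η δ i = ξ
      · obtain ⟨δ, hδ, i, hi, rfl⟩ := hown
        have h1 := hstep δ hδ (fun j hj n => ih _ (D.η_strictMono _ δ.2 (hj.trans_le hi))
          ((D.η_lt _ δ.2 j).trans hδ) n) (D.p i n)
        rw [hz δ hδ i hi, map_add, Submodule.coe_add, h1, ← D.proj_single_inl δ (D.p_mem i n), hQ,
          Finsupp.lsingle_apply, hP (t := Sum.inl _) hξ, ← map_add, ← Finsupp.single_add,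
          add_sub_cancel]
      · rw [hz₀ ξ fun δ hδ i hi h => hown ⟨δ, hδ, i, hi, h⟩, hQ, Finsupp.lsingle_apply,
          hP (t := Sum.inl _) hξ]
  have hall : ∀ t, D.pos t < α → ∀ n,
      (Q (Ψ (Finsupp.single t n)) : D.Glued) = D.proj (Finsupp.single t n) := by
    rintro (ξ | δ) ht n
    · simpa [Ψ] using hzQ ξ ht n
    · simpa [Ψ] using hstep δ ht (fun j _ n => hzQ _ ((D.η_lt _ δ.2 j).trans ht) n) n
  refine (hN.finsupp (Ω ⊕ D.E)).of_retract f Q ?_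
  rintro ⟨_, x, hx, rfl⟩
  rw [hf x hx]
  apply Subtype.ext
  show (Q (Ψ x) : D.Glued) = D.proj x
  have hx' : ∀ t ∈ x.support, D.pos t < α := fun t ht => hx ht
  rw [← Finsupp.sum_single x, Finsupp.sum, map_sum, map_sum, map_sum, Submodule.coe_sum]
  exact Finset.sum_congr rfl fun t ht => hall t (hx' t ht) _

end LadderDatum

end

/-! ### Splitting the total sum at a point of the ladder system -/

section

variable {S : Type u} [Ring S]

namespace LadderDatum

variable {N T Ω : Type u} [AddCommGroup N] [Module S N] [LinearOrder T] [LinearOrder Ω]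
  (D : LadderDatum S N T Ω)

/-- If the ladder embedding at `α` extends to a map from `N` to the part of the glued module below
`α`, then the total sum is a direct summand of `N`. -/
theorem isComplemented_total [WellFoundedLT Ω] {α α' : Ω} (hα : α ∈ D.E) (hαα' : α < α')
    {g : Ω → T} (hg : D.IsFreeBelow α' g) (φ : N →ₗ[S] D.Glued) (hφ : ∀ n, φ n ∈ D.below α)
    (hφ' : ∀ i, ∀ b ∈ D.B i, φ b = D.proj (Finsupp.single (Sum.inl (D.η α i)) b)) :
    IsComplemented D.total := by
  classical
  have hinj := (D.η_strictMono α hα).injective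
  -- The tail of the ladder at `α` is sent to the summands `B i`, everything else to zero. Freeness
  -- below `α'` covers `α` itself, so no tail at `δ < α` meets these points and the recursion
  -- preserves the values there.
  let z₀ : Ω → N →ₗ[S] D.total := fun ξ => if h : ∃ i, g α ≤ i ∧ D.η α i = ξ then
    (D.p h.choose).codRestrict D.total fun n => D.le_total _ (D.p_mem _ n) else 0
  have hz₀ : ∀ i, g α ≤ i → ∀ b ∈ D.B i, (z₀ (D.η α i) b : N) = b := fun i hi b hb => by
    have h : ∃ i', g α ≤ i' ∧ D.η α i' = D.η α i := ⟨i, hi, rfl⟩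
    have h' : h.choose = i := hinj h.choose_spec.2
    simp only [z₀, dif_pos h, LinearMap.codRestrict_apply]
    rw [h', D.p_eq i b hb]
  have hz₀' : ∀ ξ, ξ < D.η α (g α) → z₀ ξ = 0 := fun ξ hξ => dif_neg (by
    rintro ⟨i, hi, rfl⟩
    exact absurd ((D.η_strictMono α hα).monotone hi) (not_le.2 hξ))
  have hgα : D.IsFreeBelow α g := fun δ hδ hδα δ' hδ' hδα' =>
    hg δ hδ (hδα.trans hαα') δ' hδ' (hδα'.trans hαα')
  obtain ⟨z, w, hw, hz, hzu⟩ := D.exists_coherent hgα (fun _ => (0 : N →ₗ[S] D.total)) z₀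
  obtain ⟨f, hf⟩ := D.exists_desc (Finsupp.lsum ℕ (Sum.elim z w))
    (lsum_rel_eq_zero.{u} (y := fun δ j => if j < g δ then z (D.η δ j) else 0) (z₀ := z₀)
      (v := fun _ => 0) (fun δ j hj => if_pos hj) hw hz)
  let ρ : N →ₗ[S] D.total := f ∘ₗ φ.codRestrict (D.below α) hφ
  have hρ : ∀ i, ∀ b ∈ D.B i, ρ b = z (D.η α i) b := fun i b hb => by
    have hm : Finsupp.single (Sum.inl (D.η α i)) b ∈ D.freeBelow α :=
      Finsupp.single_mem_supported S b (show D.pos (Sum.inl (D.η α i)) < α from D.η_lt α hα i)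
    have h1 : φ.codRestrict (D.below α) hφ b = ⟨D.proj (Finsupp.single (Sum.inl (D.η α i)) b),
        _, hm, rfl⟩ := Subtype.ext (hφ' i b hb)
    rw [LinearMap.comp_apply, h1, hf _ hm]
    simp
  have hρ₁ : ∀ i, g α ≤ i → ∀ b ∈ D.B i, (ρ b : N) = b := fun i hi b hb => by
    rw [hρ i b hb, hzu _ fun δ hδ j hj h => ?_, hz₀ i hi b hb]
    exact hg δ δ.2 (hδ.trans hαα') α hα hαα' hδ.ne j hj i hi h
  -- Before the tail at `α` begins, all initial data vanish, hence so do the recursively defined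
  -- values.
  have hzero : ∀ ξ, ξ < D.η α (g α) → z ξ = 0 := by
    intro ξ
    induction ξ using WellFoundedLT.induction with
    | ind ξ ih =>
      intro hξ
      by_cases hown : ∃ δ : D.E, δ.1 < α ∧ ∃ i, g δ ≤ i ∧ D.η δ i = ξ
      · obtain ⟨δ, hδ, i, hi, rfl⟩ := hown
        have h1 : (fun j => if j < g δ then z (D.η δ j) else 0) = fun _ => 0 := funext fun j => by
          by_cases hj : j < g δ
          · have h2 := D.η_strictMono _ δ.2 (hj.trans_le hi)
            rw [if_pos hj, ih _ h2 (h2.trans hξ)]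
          · rw [if_neg hj]
        have h2 : ∀ n, w δ n = 0 := fun n => by
          rw [hw, h1, LinearMap.zero_apply, zero_add]
          exact D.eq_zero_of_forall (fun i b hb => by rw [D.glue_apply _ hb]; rfl) _
        ext n
        rw [hz δ hδ i hi, h2, hz₀' _ hξ]
        simp
      · rw [hzu ξ fun δ hδ i hi h => hown ⟨δ, hδ, i, hi, h⟩, hz₀' _ hξ]
  have hρ₂ : ∀ i, i < g α → ∀ b ∈ D.B i, ρ b = 0 := fun i hi b hb => by
    rw [hρ i b hb, hzero _ (D.η_strictMono α hα hi), LinearMap.zero_apply]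
  -- `ρ` is the identity on `B i` for `i ≥ g α` and zero for `i < g α`; the projection onto the head
  -- repairs the latter without disturbing the former.
  let q : N →ₗ[S] N := D.total.subtype ∘ₗ ρ +
    D.π (g α) ∘ₗ (LinearMap.id - D.total.subtype ∘ₗ ρ)
  refine Submodule.isComplemented_iff_exists_proj.2 ⟨q, fun n =>
    add_mem (ρ n).2 (D.π_mem_total _ _), fun n hn => ?_⟩
  have h := D.eq_zero_of_forall (G := q ∘ₗ D.total.subtype - D.total.subtype) (fun i b hb => ?_)
    ⟨n, hn⟩
  · exact sub_eq_zero.1 h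
  · rcases lt_or_ge i (g α) with hi | hi
    · simp [q, hρ₂ i hi _ hb, D.π_eq _ i hi _ hb]
    · simp [q, hρ₁ i hi _ hb]

end LadderDatum

/-! ### Covers of filtered modules -/

variable {M : Type u} [AddCommGroup M] [Module S M]

/-- Lift the inclusion of `F'` through `f` to `h`. Then `θ = h f r + (1 - r)` satisfies `f θ = f`,
so it is invertible. Since `θ` sends a fixed point `c` of `r` to `h (f c)`, the map `f r θ⁻¹ h` is
the identity on `F`. -/
theorem IsCover.exists_retraction {C X : Type u} [AddCommGroup C] [Module S C] [AddCommGroup X]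
    [Module S X] {f : C →ₗ[S] X} {𝒞 : ModuleClass S} (hf : IsCover 𝒞 f)
    {F F' : Submodule S X} (hFF' : F ≤ F') (hF' : 𝒞 F') (r : C →ₗ[S] C) (hr : ∀ c, f (r c) ∈ F)
    (hr' : ∀ x ∈ F, ∃ c, r c = c ∧ f c = x) :
    ∃ ρ : F' →ₗ[S] X, (∀ x, ρ x ∈ F) ∧ ∀ x : F', x.1 ∈ F → ρ x = x := by
  obtain ⟨h, hh⟩ := hf.exists_lift F' hF' F'.subtype
  have hh' : ∀ x, f (h x) = x := fun x => LinearMap.congr_fun hh x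
  let θ : C →ₗ[S] C := h ∘ₗ (f ∘ₗ r).codRestrict F' (fun c => hFF' (hr c)) + (LinearMap.id - r)
  have hθ : f ∘ₗ θ = f := by
    ext c
    simp [θ, hh']
  let e := LinearEquiv.ofBijective θ (hf.bijective θ hθ)
  refine ⟨f ∘ₗ r ∘ₗ e.symm.toLinearMap ∘ₗ h, fun x => hr _, fun x hx => ?_⟩
  obtain ⟨c, hc, hcx⟩ := hr' x hx
  have h1 : e.symm (h x) = c := by
    rw [LinearEquiv.symm_apply_eq]
    have : (f ∘ₗ r).codRestrict F' (fun c => hFF' (hr c)) c = x :=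
      Subtype.ext (by simp [hc, hcx])
    simp [e, θ, this, hc]
  simp [h1, hc, hcx]

/-- A map from a module in `Add(M)` onto a filtered module admits, at all closed stages of the
filtration, an endomorphism of the domain splitting off a part mapped onto that stage. -/
theorem AddClass.exists_endomorphism {C X Ω : Type u} [AddCommGroup C] [Module S C]
    [AddCommGroup X] [Module S X] [LinearOrder Ω] (hC : AddClass (S := S) M C) (f : C →ₗ[S] X)
    {κ : Cardinal.{u}} (hκ : ℵ₀ ≤ κ) (hMκ : #M ≤ κ)
    (hΩ : ∀ s : Set Ω, #s ≤ κ → ∃ a, ∀ x ∈ s, x < a) {F : Ω → Submodule S X} (hF : Monotone F)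
    (hFX : ∀ x, ∃ α, x ∈ F α) {A : Ω → Set X} (hA : ∀ β, #(A β) ≤ κ) (hAf : ∀ β, ∀ x ∈ A β, ∃ c, f c = x)
    (hAF : ∀ α (K : Submodule S X), (∀ β < α, A β ⊆ K) → F α ≤ K) :
    ∃ ψ : Ω → Ω, ∀ α, (∀ β < α, ψ β < α) → ∃ r : C →ₗ[S] C, (∀ c, f (r c) ∈ F α) ∧
      ∀ x ∈ F α, ∃ c, r c = c ∧ f c = x := by
  classical
  obtain ⟨I, i, p, hip⟩ := addClass_iff.1 hC
  choose! c hc using hAf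
  choose γ hγ using hFX
  let J : Ω → Set I := fun β => ⋃ x : A β, ((i (c β x)).support : Set I)
  have hJ : ∀ β, #(J β) ≤ κ := fun β => by
    refine (mk_iUnion_le _).trans (mul_le_of_le hκ (hA β) (ciSup_le' fun x => ?_))
    exact (lt_aleph0_of_finite _).le.trans hκ
  -- `J β` collects the coordinates used by chosen preimages of `A β`. At most `κ` elements are
  -- supported on one of these coordinates, so their images all lie below a single stage.
  have hψ : ∀ β, ∃ a, ∀ j ∈ J β, ∀ m, γ (f (p (Finsupp.single j m))) < a := fun β => by
    obtain ⟨a, ha⟩ := hΩ (range fun jm : J β × M => γ (f (p (Finsupp.single jm.1.1 jm.2)))) (by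
      refine mk_range_le.trans ?_
      rw [mk_prod, lift_id, lift_id]
      exact mul_le_of_le hκ (hJ β) hMκ)
    exact ⟨a, fun j hj m => ha _ ⟨(⟨j, hj⟩, m), rfl⟩⟩
  choose ψ hψ using hψ
  refine ⟨ψ, fun α hα => ?_⟩
  let J' : Set I := ⋃ β < α, J β
  -- Restriction to the coordinates collected before `α` fixes the chosen preimages of the
  -- generators of `F α`, while closure under `ψ` keeps its image under `f ∘ p` inside `F α`.
  let P : (I →₀ M) →ₗ[S] (I →₀ M) := (Finsupp.supported M S J').subtype ∘ₗ
    Finsupp.restrictDom M S J'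
  refine ⟨p ∘ₗ P ∘ₗ i, fun x => ?_, ?_⟩
  · have hsupp : ∀ j ∈ (P (i x)).support, j ∈ J' := fun j hj =>
      (Finsupp.restrictDom M S J' (i x)).2 hj
    rw [LinearMap.comp_apply, LinearMap.comp_apply, ← Finsupp.sum_single (P (i x)), Finsupp.sum,
      map_sum, map_sum]
    refine sum_mem fun j hj => ?_
    obtain ⟨β, hβ, hjβ⟩ := mem_iUnion₂.1 (hsupp j hj)
    exact hF ((hψ β j hjβ _).trans (hα β hβ)).le (hγ _)
  · let K : Submodule S X := (LinearMap.eqLocus (p ∘ₗ P ∘ₗ i) LinearMap.id).map f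
    have hK : F α ≤ K := hAF α K fun β hβ x hx => by
      refine ⟨c β x, ?_, hc β x hx⟩
      have h1 : i (c β x) ∈ Finsupp.supported M S J' := fun j hj =>
        mem_iUnion₂.2 ⟨β, hβ, mem_iUnion.2 ⟨⟨x, hx⟩, hj⟩⟩
      have h2 : P (i (c β x)) = i (c β x) := by
        have := LinearMap.congr_fun (Finsupp.restrictDom_comp_subtype (M := M) (R := S) J') ⟨_, h1⟩
        exact congrArg Subtype.val this
      show (p ∘ₗ P ∘ₗ i) (c β x) = c β x
      simp only [LinearMap.comp_apply]
      rw [h2, hip]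
    intro x hx
    obtain ⟨y, hy, hyx⟩ := hK hx
    exact ⟨y, hy, hyx⟩

/-- If all direct limits of modules in `Add(M)` have `Add(M)`-covers, then `M` has a perfect
decomposition. -/
theorem NonReflectionAssumption.hasPerfectDecomposition (hstar : NonReflectionAssumption.{u})
    (hM : ∀ (L : Type u) [AddCommGroup L] [Module S L],
      DirLimClass (AddClass (S := S) M) L → HasCover (AddClass (S := S) M) L) :
    HasPerfectDecomposition S M := by
  by_contra hnot
  obtain ⟨N, _, _, c, B, hN, hc, hB, hBc, hBc', hBnot⟩ :=
    exists_minimal_of_not_hasPerfectDecomposition hnot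
  obtain ⟨κ, hνκ, hκ, Ω, _, _, E, η, _, hΩ, hη, hE, hfree⟩ :=
    hstar.exists_free_ladder_system hc (max #N #M)
  obtain ⟨hNκ, hMκ⟩ := max_le_iff.1 hνκ
  have : NoMaxOrder Ω := ⟨fun a => by
    obtain ⟨b, hb⟩ := hΩ {a} (by simpa using one_le_aleph0.trans hκ)
    exact ⟨b, hb a rfl⟩⟩
  simp only [Submodule.isComplemented_iff_exists_proj] at hBc hBc'
  choose p hp hp' using hBc
  choose π hπ hπ' using hBc'
  let D : LadderDatum S N c.ord.ToType Ω := {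
    B := B, indep := hB, p := p, p_mem := hp, p_eq := hp', π := π, π_mem := hπ
    π_eq := fun a i hi x hx => hπ' a x ((le_iSup₂_of_le i hi le_rfl : B i ≤ ⨆ i < a, B i) hx)
    E := E, η := η, η_strictMono := fun δ hδ => (hη δ hδ).1, η_lt := fun δ hδ => (hη δ hδ).2 }
  have hbelow : ∀ α, AddClass (S := S) M (D.below α) := fun α => by
    obtain ⟨g, hg⟩ := hfree α
    exact D.below_mem_addClass hN (g := g) hg
  obtain ⟨C, _, _, f, hf⟩ := hM D.Glued
    (DirLimClass.of_directed_iSup D.below D.below_mono D.exists_mem_below hbelow)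
  have hsurj : ∀ x, ∃ y, f y = x := fun x => by
    obtain ⟨α, hα⟩ := D.exists_mem_below x
    obtain ⟨h, hh⟩ := hf.exists_lift _ (hbelow α) (D.below α).subtype
    exact ⟨h ⟨x, hα⟩, LinearMap.congr_fun hh ⟨x, hα⟩⟩
  let A : Ω → Set D.Glued := fun β =>
    range fun tn : {t // D.pos t = β} × N => D.proj (Finsupp.single tn.1.1 tn.2)
  have hA : ∀ β, #(A β) ≤ κ := fun β => by
    -- At most two copies of `N` sit at position `β`: the original one and the one glued on if `β ∈
    -- E`.
    have hfin : Finite {t // D.pos t = β} := by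
      refine Finite.of_injective (β := Bool) (fun t => t.1.isLeft) ?_
      rintro ⟨ξ | δ, h⟩ ⟨ξ' | δ', h'⟩ heq
      · exact Subtype.ext (congrArg Sum.inl (h.trans h'.symm))
      · simp at heq
      · simp at heq
      · exact Subtype.ext (congrArg Sum.inr (Subtype.ext (h.trans h'.symm)))
    refine mk_range_le.trans ?_
    rw [mk_prod, lift_id, lift_id]
    exact mul_le_of_le hκ ((lt_aleph0_of_finite _).le.trans hκ) hNκ
  obtain ⟨ψ, hψ⟩ := hf.mem.exists_endomorphism f hκ hMκ hΩ D.below_mono D.exists_mem_below hA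
    (fun β x _ => hsurj x) fun α K hK => D.below_le fun t ht n => hK _ ht ⟨(⟨t, rfl⟩, n), rfl⟩
  obtain ⟨α, hα, hαψ⟩ := hE ψ
  obtain ⟨r, hr, hr'⟩ := hψ α hαψ
  obtain ⟨α', hαα'⟩ := exists_gt α
  obtain ⟨g, hg⟩ := hfree α'
  obtain ⟨ρ, hρ, hρ'⟩ := hf.exists_retraction (D.below_mono hαα'.le) (hbelow α') r hr hr'
  -- The copy of `N` at `α` appears only beyond stage `α`, but its submodules `B i` are identified
  -- with ones below `α`, where `ρ` is the identity. So `ρ ∘ j` extends the ladder embedding.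
  let j : N →ₗ[S] D.below α' := (D.proj ∘ₗ Finsupp.lsingle (Sum.inr ⟨α, hα⟩)).codRestrict _
    fun n => D.proj_single_mem_below (t := Sum.inr ⟨α, hα⟩) hαα' n
  refine hBnot (D.isComplemented_total hα hαα' (g := g) hg (ρ ∘ₗ j) (fun n => hρ _)
    fun i b hb => ?_)
  have h1 : (j b).1 = D.proj (Finsupp.single (Sum.inl (η α i)) b) :=
    (D.proj_single_inl ⟨α, hα⟩ hb).symm
  rw [LinearMap.comp_apply, hρ' _ ?_, h1]
  rw [h1]
  exact D.proj_single_mem_below (t := Sum.inl (η α i)) ((hη α hα).2 i) b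

end

/-- Right `R`-modules are modules over the opposite ring `Rᵐᵒᵖ`. -/
theorem theorem2p2 (hstar : NonReflectionAssumption.{u}) {R : Type u} [Ring R]
    (M : Type u) [AddCommGroup M] [Module Rᵐᵒᵖ M]
    (hM : ∀ (L : Type u) [AddCommGroup L] [Module Rᵐᵒᵖ L],
      DirLimClass (AddClass (S := Rᵐᵒᵖ) M) L → HasCover (AddClass (S := Rᵐᵒᵖ) M) L) :
    HasPerfectDecomposition Rᵐᵒᵖ M ∧ ClosedUnderDirectLimits (AddClass (S := Rᵐᵒᵖ) M) :=
  have h := hstar.hasPerfectDecomposition hM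
  ⟨h, h.closedUnderDirectLimits⟩
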